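/- Let $p\in\mathbb R$, $p\neq 0$, let $\sigma^2\in\{1,-1\}$, and consider the potential gKP equation $$v_{tx}+v_x^{\,p}v_{xx}+v_{xxxx}+\sigma^2v_{yy}=0 \qquad (1)$$ for smooth functions $v(x,y,t)$ on open subsets of $\mathbb R^3$, where $v_x$ takes values at which the real power $v_x^{\,p}$ is defined and smooth ($v_x>0$; also $v_x\neq0$ if $p$ is an integer; any $v_x$ if $p$ is a natural number). Let $W\subseteq\mathbb R^4$ be a nonempty open convex set of points $(x,y,t,v)$, and let $J$ be its projection to the $t$-axis. A (Lie) point symmetry of (1) on $W$ is a generator $\mathrm X=\xi^x\partial_x+\xi^y\partial_y+\tau\partial_t+\eta\partial_v$ whose coefficients are smooth functions of $(x,y,t,v)\in W$, such that $P=\eta-\xi^xv_x-\xi^yv_y-\tau v_t$ satisfies $$D_x\big(D_tP+v_x^{\,p}D_xP+D_x^3P\big)+\sigma^2D_y^2P=0$$ for all solutions $v$ of (1) with graph in $W$. Below, $f_1,\dots,f_5$ denote smooth real functions on $J$. (i) For every $p\ne0$ the following generators are point symmetries, and so are all their linear combinations: the translations $\partial_x,\ \partial_y,\ \partial_t$;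 the scaling $x\partial_x+2y\partial_y+3t\partial_t+(1-\tfrac2p)v\,\partial_v$; the rotation-boost $y\partial_x-2\sigma^2t\,\partial_y$; and the shifts $\big(f_1(t)+f_2(t)y\big)\partial_v$ with arbitrary $f_1,f_2$. If $p\ne1$, every point symmetry is such a linear combination. (ii) If $p=1$, then for arbitrary $f_3,f_4,f_5$ the generator $\mathrm X_7$ with $$\tau=f_3,\qquad \xi^x=-\tfrac16\sigma^2f_3''y^2-\tfrac12\sigma^2f_4'y+\tfrac13f_3'x+f_5,\qquad \xi^y=\tfrac23f_3'y+f_4,$$ $$\eta=\tfrac1{72}f_3''''y^4+\tfrac1{12}f_4'''y^3-\tfrac16\sigma^2f_3'''y^2x-\tfrac12\sigma^2f_5''y^2-\tfrac12\sigma^2f_4''yx+\tfrac16f_3''x^2+f_5'x-\tfrac13f_3'v$$ is a point symmetry, and every point symmetry is the sum of a generator $\mathrm X_7$ and a shift $\big(f_1(t)+f_2(t)y\big)\partial_v$. Different triples $(f_3,f_4,f_5)$ give different generators $\mathrm X_7$, so that these form three infinite-dimensional families. A generator $\mathrm X_7$ is a linear combination of the generators in (i) if and only if $f_3''=f_4''=f_5'=0$;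 the scaling is the case $f_3=3t$, $f_4=f_5=0$. -/

import Mathlib

open scoped ContDiff

namespace GKP

/-- The space of independent variables, with points `(x, y, t)`. -/
abbrev Base := ℝ × ℝ × ℝ

/-- The space of independent and dependent variables, with points `(x, y, t, v)`. -/
abbrev Total := ℝ × ℝ × ℝ × ℝ

/-- The partial derivative `∂w/∂x`. -/
noncomputable def Dx (w : Base → ℝ) : Base → ℝ := fun q => fderiv ℝ w q (1, 0, 0)

/-- The partial derivative `∂w/∂y`. -/
noncomputable def Dy (w : Base → ℝ) : Base → ℝ := fun q => fderiv ℝ w q (0, 1, 0)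

/-- The partial derivative `∂w/∂t`. -/
noncomputable def Dt (w : Base → ℝ) : Base → ℝ := fun q => fderiv ℝ w q (0, 0, 1)

/-- The values `a` near which the real power `a ^ p` is defined and smooth: all positive `a`, for an
integer `p` all nonzero `a`, and for a natural number `p` all real `a`. -/
def PowerDomain (p a : ℝ) : Prop :=
  0 < a ∨ (a ≠ 0 ∧ ∃ n : ℤ, p = n) ∨ ∃ n : ℕ, p = n

/-- The expression `v_tx + v_x ^ p v_xx + v_xxxx + σ² v_yy`; the argument `s` stands for `σ²`. -/
noncomputable def gkpPotential (p s : ℝ) (v : Base → ℝ) (q : Base) : ℝ :=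
  Dx (Dt v) q + (Dx v q) ^ p * Dx (Dx v) q + Dx (Dx (Dx (Dx v))) q + s * Dy (Dy v) q

/-- `v` is a smooth (local) solution of the potential gKP equation on the open set `U`. -/
structure IsSolutionOn (p s : ℝ) (U : Set Base) (v : Base → ℝ) : Prop where
  isOpen : IsOpen U
  contDiffOn : ContDiffOn ℝ ∞ v U
  powerDomain : ∀ q ∈ U, PowerDomain p (Dx v q)
  equation : ∀ q ∈ U, gkpPotential p s v q = 0

/-- A generator `ξˣ ∂_x + ξʸ ∂_y + τ ∂_t + η ∂_v`, given by its components
`(ξˣ, ξʸ, τ, η)` as functions of `(x, y, t, v)`. -/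
abbrev Generator := Total → ℝ × ℝ × ℝ × ℝ

/-- The point `(x, y, t, v(x, y, t))` of the graph of `v`. -/
def graphPoint (v : Base → ℝ) (q : Base) : Total := (q.1, q.2.1, q.2.2, v q)

/-- The characteristic `P = η - ξˣ v_x - ξʸ v_y - τ v_t` of `X`, evaluated on the function `v`. -/
noncomputable def characteristic (X : Generator) (v : Base → ℝ) (q : Base) : ℝ :=
  (X (graphPoint v q)).2.2.2 - (X (graphPoint v q)).1 * Dx v q
    - (X (graphPoint v q)).2.1 * Dy v q - (X (graphPoint v q)).2.2.1 * Dt v q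

/-- The linearization `D_x (D_t P + v_x ^ p D_x P + D_x³ P) + σ² D_y² P` of the potential gKP
equation at `v`, applied to the function `P`. -/
noncomputable def linearization (p s : ℝ) (v P : Base → ℝ) (q : Base) : ℝ :=
  Dx (fun r => Dt P r + (Dx v r) ^ p * Dx P r + Dx (Dx (Dx P)) r) q + s * Dy (Dy P) q

/-- `X` is an infinitesimal point symmetry of the potential gKP equation, with smooth coefficients
on the open set `W` of `(x, y, t, v)`-space: the invariance condition holds for all solutions
whose graph lies in `W`. -/
structure IsPointSymmetry (p s : ℝ) (W : Set Total) (X : Generator) : Prop where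
  contDiffOn : ContDiffOn ℝ ∞ X W
  invariance : ∀ (U : Set Base) (v : Base → ℝ), IsSolutionOn p s U v →
    (∀ q ∈ U, graphPoint v q ∈ W) →
    ∀ q ∈ U, linearization p s v (characteristic X v) q = 0

/-- The translation in `x`. -/
def X1 : Generator := fun _ => (1, 0, 0, 0)

/-- The translation in `y`. -/
def X2 : Generator := fun _ => (0, 1, 0, 0)

/-- The translation in `t`. -/
def X3 : Generator := fun _ => (0, 0, 1, 0)

/-- The scaling `x ∂_x + 2y ∂_y + 3t ∂_t + (1 - 2/p) v ∂_v`. -/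
noncomputable def X4 (p : ℝ) : Generator :=
  fun (x, y, t, v) => (x, 2 * y, 3 * t, (1 - 2 / p) * v)

/-- The rotation-boost `y ∂_x - 2σ²t ∂_y`. -/
def X5 (s : ℝ) : Generator := fun (_, y, t, _) => (y, -2 * s * t, 0, 0)

/-- The shifts `(f₁(t) + f₂(t) y) ∂_v`. -/
def X6 (f₁ f₂ : ℝ → ℝ) : Generator := fun (_, y, t, _) => (0, 0, 0, f₁ t + f₂ t * y)

/-- The generator with `τ = f₃(t)` which depends on three arbitrary functions of `t`. -/
noncomputable def X7 (s : ℝ) (f₃ f₄ f₅ : ℝ → ℝ) : Generator := fun (x, y, t, v) =>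
  (-(1 / 6) * s * iteratedDeriv 2 f₃ t * y ^ 2 - 1 / 2 * s * deriv f₄ t * y
      + 1 / 3 * deriv f₃ t * x + f₅ t,
    2 / 3 * deriv f₃ t * y + f₄ t,
    f₃ t,
    1 / 72 * iteratedDeriv 4 f₃ t * y ^ 4 + 1 / 12 * iteratedDeriv 3 f₄ t * y ^ 3
      - 1 / 6 * s * iteratedDeriv 3 f₃ t * y ^ 2 * x - 1 / 2 * s * iteratedDeriv 2 f₅ t * y ^ 2
      - 1 / 2 * s * iteratedDeriv 2 f₄ t * y * x + 1 / 6 * iteratedDeriv 2 f₃ t * x ^ 2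
      + deriv f₅ t * x - 1 / 3 * deriv f₃ t * v)

/-- The set of values of `t` on `W`. -/
def timeSet (W : Set Total) : Set ℝ := (fun z : Total => z.2.2.1) '' W

/-- On `W`, the generator `X` is a linear combination of the translations, the scaling, the
rotation-boost, and a shift with smooth coefficient functions of `t`. -/
def IsBasic (p s : ℝ) (W : Set Total) (X : Generator) : Prop :=
  ∃ (c₁ c₂ c₃ c₄ c₅ : ℝ) (f₁ f₂ : ℝ → ℝ),
    ContDiffOn ℝ ∞ f₁ (timeSet W) ∧ ContDiffOn ℝ ∞ f₂ (timeSet W) ∧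
    Set.EqOn X (c₁ • X1 + c₂ • X2 + c₃ • X3 + c₄ • X4 p + c₅ • X5 s + X6 f₁ f₂) W

end GKP

/-! Write ξ, ζ, τ, η for the four coefficients and E for the left side of the equation. Being a
point symmetry is equivalent to the linear system `Determining`: τ depends on t only, ζ on (y, t), ξ
on (x, y, t); ξ_x = τ'/3, ζ_y = 2τ'/3, ζ_t = -2σ²ξ_y, η_v = (1 - 2/p)τ'/3, η_tx + σ²η_yy = 0; and
either η_x = ξ_t = 0, or p = 1 and η_x = ξ_t.

Sufficiency is `GraphCalculus.lin_char_eq_zero`: the system turns the linearized operator on the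
characteristic into a combination of E, D_xE, D_yE and D_tE, which vanish on solutions. Smooth
functions form an algebra with commuting derivations, so this is the Leibniz rule followed by a
polynomial identity.

For necessity it is enough to test the invariance condition on few explicit solutions through each
point of W (`exists_wave`, `exists_profile`): functions affine in x plus a polynomial in y and t,
stationary waves, and travelling waves in x + ky - ct whose profile solves an ordinary differential
equation. The condition is then polynomial in free parameters of the solution, and its coefficients
give the system (`determiningOn_of_forms`). The exponent p = 1 is special because η_x comes
multiplied by p·u^(p-1) and ξ_t by the constant 1, where u = v_x > 0. For p ≠ 0, 1 the functions
u^(p-1), u^p and 1 are linearly independent and both coefficients vanish, whereas for p = 1 only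
their difference does.

Finally the system is integrated. On a convex W a function with zero x-, y- and v-derivatives is a
function of t (`exists_timeFun`). If ξ_t = 0, then τ'' = 0 and only constants and a shift remain
(`exists_eq_basic`); if p = 1, then τ and the remainders of ζ and ξ are three free functions of t
(`exists_eq_X7`). -/

set_option linter.unusedSimpArgs false

/-! ### Smooth functions on an open set as an algebra with commuting derivations -/

namespace GKP

open TopologicalSpace

variable {E : Type*} [NormedAddCommGroup E] [NormedSpace ℝ E]

/-- The algebra of smooth real functions on an open set. -/
def smoothAlgebra (U : Opens E) : Subalgebra ℝ (U → ℝ) where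
  carrier := {f | ∃ g : E → ℝ, ContDiffOn ℝ ∞ g U ∧ ∀ x : U, g x = f x}
  mul_mem' := by
    rintro a b ⟨f, hf, hfa⟩ ⟨g, hg, hgb⟩
    exact ⟨fun x => f x * g x, hf.mul hg, fun x => by simp [hfa, hgb]⟩
  add_mem' := by
    rintro a b ⟨f, hf, hfa⟩ ⟨g, hg, hgb⟩
    exact ⟨fun x => f x + g x, hf.add hg, fun x => by simp [hfa, hgb]⟩
  algebraMap_mem' r := ⟨fun _ => r, contDiffOn_const, fun _ => rfl⟩

/-- The smooth function on `U` given by a function on the whole space. -/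
def restrict {U : Opens E} (g : E → ℝ) (hg : ContDiffOn ℝ ∞ g U) : smoothAlgebra U :=
  ⟨fun x => g x, g, hg, fun _ => rfl⟩

@[simp] theorem restrict_apply {U : Opens E} (g : E → ℝ) (hg : ContDiffOn ℝ ∞ g U) (x : U) :
    (restrict g hg).1 x = g x := rfl

theorem exists_restrict {U : Opens E} (f : smoothAlgebra U) :
    ∃ (g : E → ℝ) (hg : ContDiffOn ℝ ∞ g U), restrict g hg = f := by
  obtain ⟨f, g, hg, h⟩ := f
  exact ⟨g, hg, Subtype.ext (funext h)⟩

theorem contDiffOn_fderiv_apply {U : Opens E} {g : E → ℝ} (hg : ContDiffOn ℝ ∞ g U) (e : E) :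
    ContDiffOn ℝ ∞ (fun x => fderiv ℝ g x e) U :=
  (hg.fderiv_of_isOpen U.isOpen (by simp)).clm_apply contDiffOn_const

theorem differentiableAt_of_contDiffOn {U : Opens E} {F : Type*} [NormedAddCommGroup F]
    [NormedSpace ℝ F] {g : E → F} (hg : ContDiffOn ℝ ∞ g U) (x : U) :
    DifferentiableAt ℝ g x :=
  (hg.contDiffAt (U.isOpen.mem_nhds x.2)).differentiableAt (by simp)

theorem eventuallyEq_of_restrict_eq {U : Opens E} {g h : E → ℝ} {hg : ContDiffOn ℝ ∞ g U}
    {hh : ContDiffOn ℝ ∞ h U} (e : restrict g hg = restrict h hh) (x : U) :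
    g =ᶠ[nhds (x : E)] h := by
  filter_upwards [U.isOpen.mem_nhds x.2] with z hz
  exact congrFun (congrArg Subtype.val e) ⟨z, hz⟩

/-- The derivative of a smooth function on `U` in the direction `e`, as a plain map. -/
noncomputable def dirFun {U : Opens E} (e : E) (f : smoothAlgebra U) : smoothAlgebra U :=
  restrict (fun x => fderiv ℝ (exists_restrict f).choose x e)
    (contDiffOn_fderiv_apply (exists_restrict f).choose_spec.choose e)

/-- The choice of an extension in `dirFun` is immaterial: two extensions agree on the open set U,
hence near each of its points, so their derivatives there coincide. -/
theorem dirFun_restrict {U : Opens E} (e : E) (g : E → ℝ) (hg : ContDiffOn ℝ ∞ g U) :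
    dirFun e (restrict g hg) =
      restrict (fun x => fderiv ℝ g x e) (contDiffOn_fderiv_apply hg e) := by
  ext x
  have h := (exists_restrict (restrict g hg)).choose_spec.choose_spec
  simp only [dirFun, restrict_apply]
  rw [(eventuallyEq_of_restrict_eq h x).fderiv_eq]

/-- The derivative in the direction `e`, as a derivation of the algebra of smooth functions. -/
noncomputable def dir {U : Opens E} (e : E) :
    Derivation ℝ (smoothAlgebra U) (smoothAlgebra U) :=
  Derivation.mk'
    { toFun := dirFun e
      map_add' := by
        intro a b
        obtain ⟨f, hf, rfl⟩ := exists_restrict a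
        obtain ⟨g, hg, rfl⟩ := exists_restrict b
        have : restrict f hf + restrict g hg = restrict (fun x => f x + g x) (hf.add hg) := rfl
        rw [this, dirFun_restrict, dirFun_restrict, dirFun_restrict]
        ext x
        change fderiv ℝ (fun x => f x + g x) x e = fderiv ℝ f x e + fderiv ℝ g x e
        rw [fderiv_fun_add (differentiableAt_of_contDiffOn hf x)
          (differentiableAt_of_contDiffOn hg x)]
        rfl
      map_smul' := by
        intro r a
        obtain ⟨f, hf, rfl⟩ := exists_restrict a
        have : r • restrict f hf = restrict (fun x => r • f x) (hf.const_smul r) := rfl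
        rw [this, dirFun_restrict, dirFun_restrict]
        ext x
        change fderiv ℝ (fun x => r • f x) x e = r • fderiv ℝ f x e
        rw [fderiv_fun_const_smul (differentiableAt_of_contDiffOn hf x)]
        rfl }
    (by
      intro a b
      obtain ⟨f, hf, rfl⟩ := exists_restrict a
      obtain ⟨g, hg, rfl⟩ := exists_restrict b
      have : restrict f hf * restrict g hg = restrict (fun x => f x * g x) (hf.mul hg) := rfl
      change dirFun e (restrict f hf * restrict g hg) =
        restrict f hf • dirFun e (restrict g hg) + restrict g hg • dirFun e (restrict f hf)
      rw [this, dirFun_restrict, dirFun_restrict, dirFun_restrict]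
      ext x
      change fderiv ℝ (fun x => f x * g x) x e = f x * fderiv ℝ g x e + g x * fderiv ℝ f x e
      rw [fderiv_fun_mul (differentiableAt_of_contDiffOn hf x)
          (differentiableAt_of_contDiffOn hg x)]
      rfl)

theorem dir_restrict {U : Opens E} (e : E) (g : E → ℝ) (hg : ContDiffOn ℝ ∞ g U) :
    dir e (restrict g hg) =
      restrict (fun x => fderiv ℝ g x e) (contDiffOn_fderiv_apply hg e) :=
  dirFun_restrict e g hg

theorem dir_comm {U : Opens E} (e e' : E) (f : smoothAlgebra U) :
    dir e (dir e' f) = dir e' (dir e f) := by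
  obtain ⟨g, hg, rfl⟩ := exists_restrict f
  simp only [dir_restrict]
  ext x
  have hd : DifferentiableAt ℝ (fderiv ℝ g) x :=
    differentiableAt_of_contDiffOn (hg.fderiv_of_isOpen U.isOpen (m := ∞) (by simp)) x
  have h (a : E) (b : E) : fderiv ℝ (fun x => fderiv ℝ g x a) x b =
      fderiv ℝ (fderiv ℝ g) x b a := by
    rw [fderiv_clm_apply hd (differentiableAt_const a)]
    simp
  simp only [restrict_apply, h]
  exact ((hg.contDiffAt (U.isOpen.mem_nhds x.2)).isSymmSndFDerivAt
    (by simpa using WithTop.coe_le_coe.2 (le_top : (2 : ℕ∞) ≤ ⊤))).eq e e'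

/-- Evaluation at a point. -/
def ev {U : Opens E} (x : U) : smoothAlgebra U →ₐ[ℝ] ℝ where
  toFun f := f.1 x
  map_one' := rfl
  map_mul' _ _ := rfl
  map_zero' := rfl
  map_add' _ _ := rfl
  commutes' _ := rfl

@[simp] theorem ev_restrict {U : Opens E} (g : E → ℝ) (hg : ContDiffOn ℝ ∞ g U) (x : U) :
    ev x (restrict g hg) = g x := rfl

theorem ext_ev {U : Opens E} {f g : smoothAlgebra U} (h : ∀ x, ev x f = ev x g) : f = g :=
  Subtype.ext (funext h)

variable {F : Type*} [NormedAddCommGroup F] [NormedSpace ℝ F]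

/-- Composition with a smooth map between open sets. -/
def pullback {U : Opens E} {V : Opens F} (m : E → F) (hm : ContDiffOn ℝ ∞ m U)
    (h : Set.MapsTo m U V) : smoothAlgebra V →ₐ[ℝ] smoothAlgebra U where
  toFun f := ⟨fun x => f.1 ⟨m x, h x.2⟩, by
    obtain ⟨f, g, hg, hf⟩ := f
    exact ⟨g ∘ m, hg.comp hm h, fun x => hf ⟨m x, h x.2⟩⟩⟩
  map_one' := rfl
  map_mul' _ _ := rfl
  map_zero' := rfl
  map_add' _ _ := rfl
  commutes' _ := rfl

@[simp] theorem ev_pullback {U : Opens E} {V : Opens F} (m : E → F) (hm : ContDiffOn ℝ ∞ m U)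
    (h : Set.MapsTo m U V) (f : smoothAlgebra V) (x : U) :
    ev x (pullback m hm h f) = ev ⟨m x, h x.2⟩ f := rfl

theorem ev_dir_pullback {U : Opens E} {V : Opens F} (m : E → F) (hm : ContDiffOn ℝ ∞ m U)
    (h : Set.MapsTo m U V) (f : smoothAlgebra V) (e : E) (x : U) :
    ev x (dir e (pullback m hm h f)) = ev ⟨m x, h x.2⟩ (dir (fderiv ℝ m x e) f) := by
  obtain ⟨g, hg, rfl⟩ := exists_restrict f
  have : pullback m hm h (restrict g hg) = restrict (g ∘ m) (hg.comp hm h) := rfl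
  have hgx : DifferentiableAt ℝ g (m x) := differentiableAt_of_contDiffOn hg ⟨m x, h x.2⟩
  rw [this, dir_restrict, dir_restrict, ev_restrict, ev_restrict,
    fderiv_comp _ hgx (differentiableAt_of_contDiffOn hm x)]
  rfl

theorem dir_add {U : Opens E} (e e' : E) (f : smoothAlgebra U) :
    dir (e + e') f = dir e f + dir e' f := by
  obtain ⟨g, hg, rfl⟩ := exists_restrict f
  refine ext_ev fun x => ?_
  simp [dir_restrict]

theorem dir_smul {U : Opens E} (r : ℝ) (e : E) (f : smoothAlgebra U) :
    dir (r • e) f = r • dir e f := by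
  obtain ⟨g, hg, rfl⟩ := exists_restrict f
  refine ext_ev fun x => ?_
  simp [dir_restrict]

end GKP

/-! ### The determining equations and their sufficiency, in abstract differential algebra -/

namespace GKP

theorem derivation_ofNat {A : Type*} [CommRing A] [Algebra ℝ A] (D : Derivation ℝ A A) (n : ℕ)
    [n.AtLeastTwo] : D (ofNat(n) : A) = 0 :=
  D.map_natCast n

/-- The determining equations for the components of a point symmetry. -/
structure Determining {S : Type*} [CommRing S] [Algebra ℝ S] (px py pt pv : Derivation ℝ S S)
    (p s : ℝ) (ξ ζ τ η : S) : Prop where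
  τx : px τ = 0
  τy : py τ = 0
  τv : pv τ = 0
  ζx : px ζ = 0
  ζv : pv ζ = 0
  ξv : pv ξ = 0
  ξx : px ξ = algebraMap ℝ S (1 / 3) * pt τ
  ζy : py ζ = algebraMap ℝ S (2 / 3) * pt τ
  ζt : pt ζ = algebraMap ℝ S (-2 * s) * py ξ
  ηv : pv η = algebraMap ℝ S ((1 - 2 / p) / 3) * pt τ
  ηyy : pt (px η) + algebraMap ℝ S s * py (py η) = 0
  alt : (p = 1 ∧ px η = pt ξ) ∨ (px η = 0 ∧ pt ξ = 0)

/-- Commuting derivations of an algebra `R` of functions of `(x, y, t)` and an algebra `S` of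
functions of `(x, y, t, v)`, and the map `φ` which restricts the latter to the graph of `v`. -/
structure GraphCalculus (R S : Type*) [CommRing R] [Algebra ℝ R] [CommRing S] [Algebra ℝ S] where
  dx : Derivation ℝ R R
  dy : Derivation ℝ R R
  dt : Derivation ℝ R R
  px : Derivation ℝ S S
  py : Derivation ℝ S S
  pt : Derivation ℝ S S
  pv : Derivation ℝ S S
  φ : S →ₐ[ℝ] R
  v : R
  dx_dy : ∀ a, dx (dy a) = dy (dx a)
  dx_dt : ∀ a, dx (dt a) = dt (dx a)
  dy_dt : ∀ a, dy (dt a) = dt (dy a)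
  px_py : ∀ a, px (py a) = py (px a)
  px_pt : ∀ a, px (pt a) = pt (px a)
  py_pt : ∀ a, py (pt a) = pt (py a)
  pv_px : ∀ a, pv (px a) = px (pv a)
  pv_py : ∀ a, pv (py a) = py (pv a)
  pv_pt : ∀ a, pv (pt a) = pt (pv a)
  dx_φ : ∀ a, dx (φ a) = φ (px a) + φ (pv a) * dx v
  dy_φ : ∀ a, dy (φ a) = φ (py a) + φ (pv a) * dy v
  dt_φ : ∀ a, dt (φ a) = φ (pt a) + φ (pv a) * dt v

namespace GraphCalculus

variable {R S : Type*} [CommRing R] [Algebra ℝ R] [CommRing S] [Algebra ℝ S]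
  (G : GraphCalculus R S)

/-- The characteristic of the generator with components `ξ`, `ζ`, `τ`, `η`. -/
def char (ξ ζ τ η : S) : R :=
  G.φ η - G.φ ξ * G.dx G.v - G.φ ζ * G.dy G.v - G.φ τ * G.dt G.v

/-- The linearized operator, where `w` stands for `v_x ^ p`. -/
def lin (s : ℝ) (w P : R) : R :=
  G.dx (G.dt P + w * G.dx P + G.dx (G.dx (G.dx P))) + algebraMap ℝ R s * G.dy (G.dy P)

/-- The element `w₁` plays the role of v_x^(p-1). Stating the power rule through it avoids division
by v_x, which may vanish when p is a natural number. -/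
theorem lin_char_eq_zero {p s : ℝ} (hp : p ≠ 0) (hs : s * s = 1) {ξ ζ τ η : S}
    (h : Determining G.px G.py G.pt G.pv p s ξ ζ τ η) (w w₁ : R) (hw : w = w₁ * G.dx G.v)
    (hwx : G.dx w = algebraMap ℝ R p * w₁ * G.dx (G.dx G.v))
    (hwy : G.dy w = algebraMap ℝ R p * w₁ * G.dy (G.dx G.v))
    (hwt : G.dt w = algebraMap ℝ R p * w₁ * G.dt (G.dx G.v))
    (hE : G.dt (G.dx G.v) + w * G.dx (G.dx G.v) + G.dx (G.dx (G.dx (G.dx G.v)))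
      + algebraMap ℝ R s * G.dy (G.dy G.v) = 0)
    (hw1 : p = 1 → w₁ = 1) :
    G.lin s w (G.char ξ ζ τ η) = 0 := by
  have hEx := congrArg G.dx hE
  have hEy := congrArg G.dy hE
  have hEt := congrArg G.dt hE
  -- The constants become opaque elements, related only by 3c = 1, σσ = 1 and pα = pc - 2c, so that
  -- the final identity is polynomial. Here `σ` is the image of `s`, that is, of σ² in the equation.
  obtain ⟨c, hc⟩ : ∃ c : S, c = algebraMap ℝ S (1 / 3) := ⟨_, rfl⟩
  obtain ⟨α, hα⟩ : ∃ α : S, α = algebraMap ℝ S ((1 - 2 / p) / 3) := ⟨_, rfl⟩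
  obtain ⟨σ, hσ⟩ : ∃ σ : S, σ = algebraMap ℝ S s := ⟨_, rfl⟩
  have hc3 : 3 * c = 1 := by
    rw [hc, ← map_ofNat (algebraMap ℝ S) 3, ← map_mul]; norm_num
  have hc3R : 3 * G.φ c = 1 := by
    rw [← map_ofNat G.φ 3, ← map_mul, hc3, map_one]
  have hσσ : σ * σ = 1 := by rw [hσ, ← map_mul, hs, map_one]
  have hσσR : G.φ σ * G.φ σ = 1 := by rw [← map_mul, hσσ, map_one]
  have hαp : algebraMap ℝ R p * G.φ α = algebraMap ℝ R p * G.φ c - 2 * G.φ c := by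
    rw [hα, hc, AlgHom.commutes, AlgHom.commutes, ← map_ofNat (algebraMap ℝ R) 2, ← map_mul,
      ← map_mul, ← map_mul, ← map_sub]
    congr 1
    field_simp
  have hσR : algebraMap ℝ R s = G.φ σ := by rw [hσ, AlgHom.commutes]
  have cx : G.px c = 0 := by simp [hc]
  have cy : G.py c = 0 := by simp [hc]
  have ct : G.pt c = 0 := by simp [hc]
  have cv : G.pv c = 0 := by simp [hc]
  have αx : G.px α = 0 := by simp [hα]
  have αy : G.py α = 0 := by simp [hα]
  have αt : G.pt α = 0 := by simp [hα]
  have αv : G.pv α = 0 := by simp [hα]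
  have σx : G.px σ = 0 := by simp [hσ]
  have σy : G.py σ = 0 := by simp [hσ]
  have σt : G.pt σ = 0 := by simp [hσ]
  have σv : G.pv σ = 0 := by simp [hσ]
  have ξx : G.px ξ = c * G.pt τ := by rw [h.ξx, hc]
  have ζy : G.py ζ = 2 * c * G.pt τ := by
    rw [h.ζy, hc, ← map_ofNat (algebraMap ℝ S) 2, ← map_mul]; norm_num
  have ζt : G.pt ζ = -(2 * σ * G.py ξ) := by
    rw [h.ζt, hσ, map_mul, map_neg, map_ofNat]; ring
  have ηv : G.pv η = α * G.pt τ := by rw [h.ηv, hα]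
  have hηyy : G.pt (G.px η) + σ * G.py (G.py η) = 0 := by rw [hσ]; exact h.ηyy
  -- Compatibility of the formulas for ζ_y and ζ_t under cross differentiation.
  have ξyy : G.py (G.py ξ) = -(c * σ * G.pt (G.pt τ)) := by
    have h1 := congrArg G.pt ζy
    rw [← G.py_pt, ζt] at h1
    simp only [map_neg, Derivation.leibniz, smul_eq_mul, σy, ct, derivation_ofNat] at h1
    simp only [add_zero, mul_zero] at h1
    obtain ⟨d, hd⟩ : ∃ d : S, 2 * d = 1 := ⟨algebraMap ℝ S (1 / 2), by
      rw [← map_ofNat (algebraMap ℝ S) 2, ← map_mul]; norm_num⟩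
    linear_combination -σ * d * h1 + (-2 * d * G.py (G.py ξ)) * hσσ
      - (G.py (G.py ξ) + c * σ * G.pt (G.pt τ)) * hd
  have Kx : G.px (G.pt τ) = 0 := by rw [G.px_pt, h.τx, map_zero]
  simp only [lin, char, hσR] at hE hEx hEy hEt ⊢
  rcases h.alt with ⟨rfl, ηx⟩ | ⟨ηx, ξt⟩
  · have hw1 := hw1 rfl
    subst hw1
    simp only [map_add, map_sub, map_neg, map_mul, map_zero, Derivation.leibniz, smul_eq_mul,
      G.dx_dy, G.dx_dt, G.dy_dt, G.dx_φ, G.dy_φ, G.dt_φ, h.τx, h.τy, h.τv, h.ζx, h.ζv, h.ξv,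
      G.px_py, G.px_pt, G.py_pt, G.pv_px, G.pv_py, G.pv_pt, cx, cy, ct, cv, αx, αy, αt, αv,
      σx, σy, σt, σv, ξx, ζy, ζt, ηv, hwx, hwy, hwt, ξyy, mul_zero, zero_mul, add_zero, zero_add,
      Derivation.map_algebraMap, sub_zero, zero_sub, neg_zero, map_ofNat, derivation_ofNat,
      map_one, ηx, mul_one, one_mul] at hE hEx hEy hEt hηyy hαp ⊢
    have hηR := congrArg G.φ hηyy
    simp only [map_add, map_mul, map_zero] at hηR
    -- The point transformation moves E along the field and rescales it by η_v - 4ξ_x = (α - 4c)τ_t,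
    -- the weight of v_xxxx. The other multipliers only account for the relations between the
    -- constants.
    linear_combination -G.φ ξ * hEx - G.φ ζ * hEy - G.φ τ * hEt
      + (G.φ α - 4 * G.φ c) * G.φ (G.pt τ) * hE + hηR
      + G.dx G.v * G.φ c * G.φ (G.pt (G.pt τ)) * hσσR
      + G.φ (G.pt τ) * G.dt (G.dx G.v) * hc3R
      + (G.φ (G.pt τ) * G.dx G.v * G.dx (G.dx G.v) + G.φ (G.pt (G.pt τ)) * G.dx G.v) * hαp
      + (2 * G.φ (G.pt τ) * G.φ c * G.dx (G.dx G.v)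
          + G.φ c * G.φ (G.pt (G.pt τ))) * hw
  -- Since ξ_x = τ_t/3, the condition ξ_t = 0 forces τ_tt = 0.
  · have Kt : G.pt (G.pt τ) = 0 := by
      have := congrArg G.px ξt
      rw [G.px_pt, ξx, Derivation.leibniz, ct, map_zero, smul_zero, add_zero, smul_eq_mul] at this
      linear_combination 3 * this - G.pt (G.pt τ) * hc3
    simp only [map_add, map_sub, map_neg, map_mul, map_zero, Derivation.leibniz, smul_eq_mul,
      G.dx_dy, G.dx_dt, G.dy_dt, G.dx_φ, G.dy_φ, G.dt_φ, h.τx, h.τy, h.τv, h.ζx, h.ζv, h.ξv,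
      G.px_py, G.px_pt, G.py_pt, G.pv_px, G.pv_py, G.pv_pt, cx, cy, ct, cv, αx, αy, αt, αv,
      σx, σy, σt, σv, ξx, ζy, ζt, ηv, hwx, hwy, hwt, ξyy, mul_zero, zero_mul, add_zero, zero_add,
      Derivation.map_algebraMap, sub_zero, zero_sub, neg_zero, map_ofNat, derivation_ofNat,
      ηx, ξt, Kt] at hE hEx hEy hEt hηyy ⊢
    have hηR := congrArg G.φ hηyy
    simp only [map_mul, map_zero] at hηR
    linear_combination -G.φ ξ * hEx - G.φ ζ * hEy - G.φ τ * hEt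
      + (G.φ α - 4 * G.φ c) * G.φ (G.pt τ) * hE + hηR
      + G.φ (G.pt τ) * G.dt (G.dx G.v) * hc3R
      + w₁ * G.dx G.v * G.dx (G.dx G.v) * G.φ (G.pt τ) * hαp
      + 2 * G.φ (G.pt τ) * G.φ c * G.dx (G.dx G.v) * hw

end GraphCalculus
end GKP

/-! ### The linearized operator on three classes of test solutions -/

namespace GKP
section Forms

variable {S : Type*}

/-- The value of the linearized operator on a characteristic when `v_x = u` is constant, `v_y` and
`v_t` vanish at the point in question, and `v_tt = f`, `v_yt = g`, `v_x ^ p = W`. -/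
def slopeForm (px py pt pv : S → S) (E : S → ℝ) (s u f g W : ℝ) (ξ ζ τ η : S) :
    ℝ :=
      E (pt (px η)) + u * E (pt (pv η))
      - u * (E (pt (px ξ)) + u * E (pt (pv ξ)))
      - g * (E (px ζ) + u * E (pv ζ))
      - f * (E (px τ) + u * E (pv τ))
      + W * (E (px (px η)) + 2 * u * E (px (pv η))
        + u ^ 2 * E (pv (pv η)))
      - u * W * (E (px (px ξ)) + 2 * u * E (px (pv ξ))
        + u ^ 2 * E (pv (pv ξ)))
      + (E (px (px (px (px η)))) + 4 * u * E (px (px (px (pv η))))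
        + 6 * u ^ 2 * E (px (px (pv (pv η))))
        + 4 * u ^ 3 * E (px (pv (pv (pv η))))
        + u ^ 4 * E (pv (pv (pv (pv η)))))
      - u * (E (px (px (px (px ξ)))) + 4 * u * E (px (px (px (pv ξ))))
        + 6 * u ^ 2 * E (px (px (pv (pv ξ))))
        + 4 * u ^ 3 * E (px (pv (pv (pv ξ))))
        + u ^ 4 * E (pv (pv (pv (pv ξ)))))
      + s * (E (py (py η)) - u * E (py (py ξ))
        - 2 * g * E (py τ))

/-- The value of the linearized operator on a characteristic at a stationary wave with
`v_x = u`, `v_xx = a`, `v_xxx = b`, `v_x ^ p = W`, `v_x ^ (p - 1) = W₁`. -/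
def stationaryForm (px py pt pv : S → S) (E : S → ℝ) (p s u a b W W₁ : ℝ) (ξ η : S) :
    ℝ :=
      -10 * E (pv ξ) * a * b
      + b * (4 * (E (px (pv η)) + u * E (pv (pv η)))
        - 4 * u * (E (px (pv ξ)) + u * E (pv (pv ξ)))
        - 6 * (E (px (px ξ)) + 2 * u * E (px (pv ξ))
        + u ^ 2 * E (pv (pv ξ))))
      + a ^ 2 * (3 * E (pv (pv η)) - 15 * u * E (pv (pv ξ))
        - 12 * E (px (pv ξ)))
      + a * (-E (pt ξ)
        + p * W₁ * (E (px η) + u * E (pv η)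
          - u * (E (px ξ) + u * E (pv ξ)))
        + 2 * W * (E (px ξ) + u * E (pv ξ))
        + 6 * (E (px (px (pv η))) + 2 * u * E (px (pv (pv η)))
          + u ^ 2 * E (pv (pv (pv η))))
        - 6 * u * (E (px (px (pv ξ))) + 2 * u * E (px (pv (pv ξ)))
          + u ^ 2 * E (pv (pv (pv ξ))))
        - 4 * (E (px (px (px ξ))) + 3 * u * E (px (px (pv ξ)))
          + 3 * u ^ 2 * E (px (pv (pv ξ)))
          + u ^ 3 * E (pv (pv (pv ξ)))))
      + (E (pt (px η)) + u * E (pt (pv η))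
        - u * (E (pt (px ξ)) + u * E (pt (pv ξ)))
        + W * (E (px (px η)) + 2 * u * E (px (pv η))
          + u ^ 2 * E (pv (pv η)))
        - u * W * (E (px (px ξ)) + 2 * u * E (px (pv ξ))
          + u ^ 2 * E (pv (pv ξ)))
        + (E (px (px (px (px η)))) + 4 * u * E (px (px (px (pv η))))
          + 6 * u ^ 2 * E (px (px (pv (pv η))))
          + 4 * u ^ 3 * E (px (pv (pv (pv η))))
          + u ^ 4 * E (pv (pv (pv (pv η)))))
        - u * (E (px (px (px (px ξ))))
          + 4 * u * E (px (px (px (pv ξ))))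
          + 6 * u ^ 2 * E (px (px (pv (pv ξ))))
          + 4 * u ^ 3 * E (px (pv (pv (pv ξ))))
          + u ^ 4 * E (pv (pv (pv (pv ξ)))))
        + s * (E (py (py η)) - u * E (py (py ξ))))

/-- The value of the linearized operator on a simplified characteristic at a wave which depends on
`x + k y - c t`, with `v_x = u`, `v_xx = a`, `v_x ^ p = W`, `v_x ^ (p - 1) = W₁`. -/
def waveForm (px py pt pv : S → S) (E : S → ℝ) (p s k c u a W W₁ : ℝ) (ξ ζ τ η : S) :
    ℝ :=
      a * (p * W₁ * (E (px η) + (E (pv η) - E (px ξ)) * u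
          - E (px ζ) * k * u)
        + W * (E (pv η) - 2 * E (px ξ) - 2 * k * E (px ζ))
        + 6 * E (px (px (pv η))) - 4 * E (px (px (px ξ)))
        - (W + (s * k ^ 2 - c)) * (E (pv η) - 4 * E (px ξ)
          - 4 * k * E (px ζ))
        - c * (E (pv η) - E (px ξ) - E (pt τ))
        - E (pt ξ) - k * E (pt ζ) + c * k * E (px ζ)
        + s * (k ^ 2 * E (pv η) - 2 * k * E (py ξ)
          - 2 * k ^ 2 * E (py ζ) + 2 * c * k * E (py τ)))
      + (E (pt (px η)) + u * E (pt (pv η)) - c * u * E (px (pv η))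
        - u * E (pt (px ξ)) - k * u * E (pt (px ζ))
        + W * (E (px (px η)) + 2 * u * E (px (pv η))
          - u * E (px (px ξ)))
        + E (px (px (px (px η)))) + 4 * u * E (px (px (px (pv η))))
        - u * E (px (px (px (px ξ))))
        + s * (E (py (py η)) + 2 * k * u * E (py (pv η))
          - u * E (py (py ξ)) - k * u * E (py (py ζ))
          + c * u * E (py (py τ))))

end Forms

namespace GraphCalculus

variable {R S : Type*} [CommRing R] [Algebra ℝ R] [CommRing S] [Algebra ℝ S]
  (G : GraphCalculus R S)

/-- The linearized operator on a function `v` with constant slope `v_x = u`. -/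
theorem lin_char_of_slope {s u g f W : ℝ} {g' f' : R} (ξ ζ τ η : S)
    (vx : G.dx G.v = algebraMap ℝ R u) (vy : G.dy G.v = g') (vt : G.dt G.v = f')
    (gx : G.dx g' = 0) (gy : G.dy g' = 0) (gt : G.dt g' = algebraMap ℝ R g)
    (fx : G.dx f' = 0) (fy : G.dy f' = algebraMap ℝ R g) (ft : G.dt f' = algebraMap ℝ R f)
    (e : R →ₐ[ℝ] ℝ) (eg : e g' = 0) (ef : e f' = 0) :
    e (G.lin s (algebraMap ℝ R W) (G.char ξ ζ τ η)) =
      slopeForm G.px G.py G.pt G.pv (fun x => e (G.φ x)) s u f g W ξ ζ τ η := by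
  simp only [slopeForm, lin, char, map_add, map_sub, map_neg, map_mul, map_zero, Derivation.leibniz,
    smul_eq_mul, G.dx_φ, G.dy_φ, G.dt_φ, vx, vy, vt, gx, gy, gt, fx, fy, ft, G.pv_px, G.pv_py,
    G.pv_pt, G.px_pt, Derivation.map_algebraMap, mul_zero, add_zero, zero_add, zero_mul, eg, ef,
    AlgHom.commutes, Algebra.algebraMap_self, RingHom.id_apply]
  ring

/-- The linearized operator on a stationary wave. -/
theorem lin_char_of_stationary {s p : ℝ} {F₁ F₂ F₃ w w₁ : R} (ξ ζ τ η : S)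
    (vx : G.dx G.v = F₁) (vy : G.dy G.v = 0) (vt : G.dt G.v = 0)
    (F1x : G.dx F₁ = F₂) (F1y : G.dy F₁ = 0) (F1t : G.dt F₁ = 0)
    (F2x : G.dx F₂ = F₃) (F3x : G.dx F₃ = -(w * F₂))
    (hwx : G.dx w = algebraMap ℝ R p * w₁ * F₂)
    (e : R →ₐ[ℝ] ℝ) {u a b W W₁ : ℝ}
    (eu : e F₁ = u) (ea : e F₂ = a) (eb : e F₃ = b) (ew : e w = W) (ew1 : e w₁ = W₁) :
    e (G.lin s w (G.char ξ ζ τ η)) =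
      stationaryForm G.px G.py G.pt G.pv (fun x => e (G.φ x)) p s u a b W W₁ ξ η := by
  simp only [stationaryForm, lin, char, map_add, map_sub, map_neg, map_mul, map_zero, Derivation.leibniz,
    smul_eq_mul, G.dx_φ, G.dy_φ, G.dt_φ, vx, vy, vt, F1x, F1y, F1t, F2x, F3x, hwx,
    G.pv_px, G.pv_py, G.pv_pt, G.px_pt, Derivation.map_algebraMap, mul_zero, add_zero, zero_add,
    zero_mul, sub_zero, eu, ea, eb, ew, ew1, AlgHom.commutes, Algebra.algebraMap_self,
    RingHom.id_apply]
  ring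

/-- The linearized operator on a travelling wave, for a generator which satisfies the determining
equations that come from the highest derivatives. -/
theorem lin_char_of_wave {s p k c : ℝ} {F₁ F₂ F₃ w w₁ : R} (ξ ζ τ η : S)
    (τx : G.px τ = 0) (τv : G.pv τ = 0) (ζv : G.pv ζ = 0) (ξv : G.pv ξ = 0)
    (ηvv : G.pv (G.pv η) = 0) (ζx : G.px (G.px ζ) = 0)
    (ηxv : algebraMap ℝ S 2 * G.px (G.pv η) = algebraMap ℝ S 3 * G.px (G.px ξ))
    (vx : G.dx G.v = F₁) (vy : G.dy G.v = algebraMap ℝ R k * F₁)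
    (vt : G.dt G.v = algebraMap ℝ R (-c) * F₁)
    (F1x : G.dx F₁ = F₂) (F1y : G.dy F₁ = algebraMap ℝ R k * F₂)
    (F1t : G.dt F₁ = algebraMap ℝ R (-c) * F₂)
    (F2x : G.dx F₂ = F₃) (F2y : G.dy F₂ = algebraMap ℝ R k * F₃)
    (F3x : G.dx F₃ = -((w + algebraMap ℝ R (s * k ^ 2 - c)) * F₂))
    (hwx : G.dx w = algebraMap ℝ R p * w₁ * F₂)
    (e : R →ₐ[ℝ] ℝ) {u a b W W₁ : ℝ}
    (eu : e F₁ = u) (ea : e F₂ = a) (eb : e F₃ = b) (ew : e w = W) (ew1 : e w₁ = W₁) :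
    e (G.lin s w (G.char ξ ζ τ η)) =
      waveForm G.px G.py G.pt G.pv (fun x => e (G.φ x)) p s k c u a W W₁ ξ ζ τ η := by
  have hη := congrArg (fun z => e (G.φ z)) ηxv
  simp only [waveForm, lin, char, map_add, map_sub, map_neg, map_mul, map_zero, Derivation.leibniz,
    smul_eq_mul, G.dx_φ, G.dy_φ, G.dt_φ, vx, vy, vt, F1x, F1y, F1t, F2x, F2y, F3x, hwx,
    τx, τv, ζv, ξv, ηvv, ζx, G.px_py,
    G.pv_px, G.pv_py, G.pv_pt, G.px_pt, G.py_pt, Derivation.map_algebraMap, mul_zero, add_zero,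
    zero_add, zero_mul, sub_zero, eu, ea, eb, ew, ew1, AlgHom.commutes, Algebra.algebraMap_self,
    RingHom.id_apply, neg_zero] at hη ⊢
  -- The third derivative b occurs only with the factor 4η_xv - 6ξ_xx, which is zero by hypothesis;
  -- so `waveForm` does not contain it.
  linear_combination 2 * b * hη

end GraphCalculus
end GKP

/-! ### Real powers of v_x, and the calculus along the graph of v -/

namespace GKP

open TopologicalSpace

/-- The real power is smooth at every nonzero base, so for differentiation the three cases of
`PowerDomain` collapse to these two. -/
theorem PowerDomain.ne_or_nat {p a : ℝ} (h : PowerDomain p a) : a ≠ 0 ∨ ∃ n : ℕ, p = n := by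
  rcases h with h | h | h
  · exact Or.inl h.ne'
  · exact Or.inl h.1
  · exact Or.inr h

theorem contDiffAt_rpow_of_powerDomain {p a : ℝ} (h : PowerDomain p a) :
    ContDiffAt ℝ ∞ (fun x : ℝ => x ^ p) a := by
  rcases h.ne_or_nat with h | ⟨n, rfl⟩
  · exact Real.contDiffAt_rpow_const_of_ne h
  · simp only [Real.rpow_natCast]
    exact contDiffAt_id.pow n

theorem exists_nat_sub_one {p : ℝ} (hp : p ≠ 0) (h : ∃ n : ℕ, p = n) : ∃ n : ℕ, p - 1 = n := by
  obtain ⟨_ | n, rfl⟩ := h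
  · simp at hp
  · exact ⟨n, by push_cast; ring⟩

theorem PowerDomain.sub_one {p a : ℝ} (hp : p ≠ 0) (h : PowerDomain p a) :
    PowerDomain (p - 1) a := by
  rcases h with h | ⟨h, n, rfl⟩ | h
  · exact Or.inl h
  · exact Or.inr (Or.inl ⟨h, n - 1, by push_cast; ring⟩)
  · exact Or.inr (Or.inr (exists_nat_sub_one hp h))

theorem rpow_eq_rpow_sub_one_mul {p a : ℝ} (hp : p ≠ 0) (h : PowerDomain p a) :
    a ^ p = a ^ (p - 1) * a := by
  rcases h.ne_or_nat with ha | hn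
  · rw [Real.rpow_sub_one ha, div_mul_cancel₀ _ ha]
  · obtain ⟨n, hn⟩ := exists_nat_sub_one hp hn
    obtain rfl : p = (n + 1 : ℕ) := by push_cast; linarith
    rw [hn, Real.rpow_natCast, Real.rpow_natCast, pow_succ]

theorem hasDerivAt_rpow_of_powerDomain {p a : ℝ} (hp : p ≠ 0) (h : PowerDomain p a) :
    HasDerivAt (fun x : ℝ => x ^ p) (p * a ^ (p - 1)) a := by
  refine Real.hasDerivAt_rpow_const ?_
  rcases h.ne_or_nat with ha | ⟨n, rfl⟩
  · exact Or.inl ha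
  · exact Or.inr (by exact_mod_cast Nat.one_le_iff_ne_zero.2 (by exact_mod_cast hp))

section Power

variable {E : Type*} [NormedAddCommGroup E] [NormedSpace ℝ E] {U : Opens E}

theorem contDiffOn_rpow {g : E → ℝ} (hg : ContDiffOn ℝ ∞ g U) {p : ℝ}
    (h : ∀ q ∈ U, PowerDomain p (g q)) : ContDiffOn ℝ ∞ (fun q => g q ^ p) U := fun q hq =>
  (contDiffAt_rpow_of_powerDomain (h q hq)).comp_contDiffWithinAt q (hg q hq)

/-- The real power of a smooth function with values in the domain of the power. -/
noncomputable def power (g : E → ℝ) (hg : ContDiffOn ℝ ∞ g U) (p : ℝ)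
    (h : ∀ q ∈ U, PowerDomain p (g q)) : smoothAlgebra U :=
  restrict (fun q => g q ^ p) (contDiffOn_rpow hg h)

theorem dir_power (e : E) (g : E → ℝ) (hg : ContDiffOn ℝ ∞ g U) {p : ℝ} (hp : p ≠ 0)
    (h : ∀ q ∈ U, PowerDomain p (g q)) :
    dir e (power g hg p h) = algebraMap ℝ _ p *
      power g hg (p - 1) (fun q hq => (h q hq).sub_one hp) * dir e (restrict g hg) := by
  refine ext_ev fun x => ?_
  have := (hasDerivAt_rpow_of_powerDomain hp (h x x.2)).comp_hasFDerivAt (x : E)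
    (differentiableAt_of_contDiffOn hg x).hasFDerivAt
  simp only [power, dir_restrict, map_mul, ev_restrict, AlgHom.commutes]
  have h2 : fderiv ℝ (fun q => g q ^ p) (x : E) = _ := this.fderiv
  rw [h2]
  simp

theorem power_eq_mul (g : E → ℝ) (hg : ContDiffOn ℝ ∞ g U) {p : ℝ} (hp : p ≠ 0)
    (h : ∀ q ∈ U, PowerDomain p (g q)) :
    power g hg p h = power g hg (p - 1) (fun q hq => (h q hq).sub_one hp) * restrict g hg := by
  refine ext_ev fun x => ?_
  simp [power, rpow_eq_rpow_sub_one_mul hp (h x x.2)]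

end Power

section Graph

variable {U : Opens Base} {V : Opens Total} {v : Base → ℝ}

theorem contDiffOn_graphPoint (hv : ContDiffOn ℝ ∞ v U) : ContDiffOn ℝ ∞ (graphPoint v) U :=
  contDiff_fst.contDiffOn.prodMk ((contDiff_fst.comp contDiff_snd).contDiffOn.prodMk
    ((contDiff_snd.comp contDiff_snd).contDiffOn.prodMk hv))

theorem fderiv_graphPoint (hv : ContDiffOn ℝ ∞ v U) (q : U) (e : Base) :
    fderiv ℝ (graphPoint v) q e = (e.1, e.2.1, e.2.2, fderiv ℝ v q e) := by
  have h1 : HasFDerivAt (fun q : Base => q.1) (ContinuousLinearMap.fst ℝ ℝ (ℝ × ℝ)) (q : Base) :=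
    hasFDerivAt_fst
  have h2 : HasFDerivAt (fun q : Base => q.2) (ContinuousLinearMap.snd ℝ ℝ (ℝ × ℝ)) (q : Base) :=
    hasFDerivAt_snd
  have := h1.prodMk ((hasFDerivAt_fst.comp (q : Base) h2).prodMk
    ((hasFDerivAt_snd.comp (q : Base) h2).prodMk
      (differentiableAt_of_contDiffOn hv q).hasFDerivAt))
  have h3 : fderiv ℝ (graphPoint v) q = _ := this.fderiv
  rw [h3]
  rfl

/-- The total derivative: a tangent vector of the graph is (e, 0) plus the derivative of v along e
times the unit vector in the v-direction. -/
theorem dir_pullback_graphPoint (hv : ContDiffOn ℝ ∞ v U) (h : Set.MapsTo (graphPoint v) U V)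
    (e : Base) (a : smoothAlgebra V) :
    dir e (pullback (graphPoint v) (contDiffOn_graphPoint hv) h a) =
      pullback (graphPoint v) (contDiffOn_graphPoint hv) h (dir (e.1, e.2.1, e.2.2, 0) a) +
      pullback (graphPoint v) (contDiffOn_graphPoint hv) h (dir (0, 0, 0, 1) a) *
        dir e (restrict v hv) := by
  refine ext_ev fun q => ?_
  rw [ev_dir_pullback, fderiv_graphPoint hv]
  have : ((e.1, e.2.1, e.2.2, fderiv ℝ v q e) : Total) =
      (e.1, e.2.1, e.2.2, 0) + fderiv ℝ v q e • (0, 0, 0, 1) := by simp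
  rw [this, dir_add, dir_smul, dir_restrict]
  simp only [map_add, map_smul, map_mul, ev_pullback, ev_restrict, smul_eq_mul]
  ring

/-- The calculus of smooth functions along the graph of `v`. -/
noncomputable def graphCalculus (hv : ContDiffOn ℝ ∞ v U) (h : Set.MapsTo (graphPoint v) U V) :
    GraphCalculus (smoothAlgebra U) (smoothAlgebra V) where
  dx := dir (1, 0, 0)
  dy := dir (0, 1, 0)
  dt := dir (0, 0, 1)
  px := dir (1, 0, 0, 0)
  py := dir (0, 1, 0, 0)
  pt := dir (0, 0, 1, 0)
  pv := dir (0, 0, 0, 1)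
  φ := pullback (graphPoint v) (contDiffOn_graphPoint hv) h
  v := restrict v hv
  dx_dy := dir_comm _ _
  dx_dt := dir_comm _ _
  dy_dt := dir_comm _ _
  px_py := dir_comm _ _
  px_pt := dir_comm _ _
  py_pt := dir_comm _ _
  pv_px := dir_comm _ _
  pv_py := dir_comm _ _
  pv_pt := dir_comm _ _
  dx_φ := dir_pullback_graphPoint hv h _
  dy_φ := dir_pullback_graphPoint hv h _
  dt_φ := dir_pullback_graphPoint hv h _

/-- The components `ξˣ`, `ξʸ`, `τ`, `η` of a generator as smooth functions. -/
noncomputable def xiX {X : Generator} (hX : ContDiffOn ℝ ∞ X V) : smoothAlgebra V :=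
  restrict (fun z => (X z).1) hX.fst

/-- The component along `∂/∂y` of a smooth generator. -/
noncomputable def xiY {X : Generator} (hX : ContDiffOn ℝ ∞ X V) : smoothAlgebra V :=
  restrict (fun z => (X z).2.1) hX.snd.fst

/-- The component along `∂/∂t` of a smooth generator. -/
noncomputable def tau {X : Generator} (hX : ContDiffOn ℝ ∞ X V) : smoothAlgebra V :=
  restrict (fun z => (X z).2.2.1) hX.snd.snd.fst

/-- The component along `∂/∂v` of a smooth generator. -/
noncomputable def eta {X : Generator} (hX : ContDiffOn ℝ ∞ X V) : smoothAlgebra V :=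
  restrict (fun z => (X z).2.2.2) hX.snd.snd.snd

theorem contDiffOn_Dx (hv : ContDiffOn ℝ ∞ v U) : ContDiffOn ℝ ∞ (Dx v) U :=
  contDiffOn_fderiv_apply hv _

theorem restrict_characteristic {X : Generator} (hX : ContDiffOn ℝ ∞ X V)
    (hv : ContDiffOn ℝ ∞ v U) (h : Set.MapsTo (graphPoint v) U V) :
    ∃ hP : ContDiffOn ℝ ∞ (characteristic X v) U, restrict (characteristic X v) hP =
      (graphCalculus hv h).char (xiX hX) (xiY hX) (tau hX) (eta hX) := by
  have hXv : ContDiffOn ℝ ∞ (fun q => X (graphPoint v q)) U :=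
    hX.comp (contDiffOn_graphPoint hv) h
  have hP : ContDiffOn ℝ ∞ (characteristic X v) U :=
    ((hXv.snd.snd.snd.sub (hXv.fst.mul (contDiffOn_fderiv_apply hv _))).sub
      (hXv.snd.fst.mul (contDiffOn_fderiv_apply hv _))).sub
      (hXv.snd.snd.fst.mul (contDiffOn_fderiv_apply hv _))
  refine ⟨hP, ext_ev fun q => ?_⟩
  have e1 : ev q (dir (1, 0, 0) (restrict v hv)) = Dx v q := by rw [dir_restrict]; rfl
  have e2 : ev q (dir (0, 1, 0) (restrict v hv)) = Dy v q := by rw [dir_restrict]; rfl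
  have e3 : ev q (dir (0, 0, 1) (restrict v hv)) = Dt v q := by rw [dir_restrict]; rfl
  simp only [GraphCalculus.char, graphCalculus, map_sub, map_mul, ev_pullback, e1, e2, e3]
  rfl

/-- The bridge from the pointwise invariance condition to the algebraic operator. All functions
involved are smooth on U, so iterated Fréchet derivatives become iterated derivations. -/
theorem linearization_eq_ev_lin {p s : ℝ} {X : Generator} (hX : ContDiffOn ℝ ∞ X V)
    (hv : ContDiffOn ℝ ∞ v U) (h : Set.MapsTo (graphPoint v) U V)
    (hd : ∀ q ∈ U, PowerDomain p (Dx v q)) (q : U) :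
    linearization p s v (characteristic X v) q =
      ev q ((graphCalculus hv h).lin s (power (Dx v) (contDiffOn_Dx hv) p hd)
        ((graphCalculus hv h).char (xiX hX) (xiY hX) (tau hX) (eta hX))) := by
  obtain ⟨hP, e⟩ := restrict_characteristic hX hv h
  rw [← e]
  have hx := contDiffOn_fderiv_apply hP (1, 0, 0)
  have hxx := contDiffOn_fderiv_apply hx (1, 0, 0)
  have hxxx := contDiffOn_fderiv_apply hxx (1, 0, 0)
  have ht := contDiffOn_fderiv_apply hP (0, 0, 1)
  have hw := contDiffOn_rpow (contDiffOn_Dx hv) hd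
  have : (dir (0, 0, 1) (restrict _ hP) + power (Dx v) (contDiffOn_Dx hv) p hd *
      dir (1, 0, 0) (restrict _ hP) +
      dir (1, 0, 0) (dir (1, 0, 0) (dir (1, 0, 0) (restrict _ hP)))) =
      restrict _ ((ht.add (hw.mul hx)).add hxxx) := by
    simp only [dir_restrict]
    rfl
  change _ = ev q (dir (1, 0, 0) (dir (0, 0, 1) (restrict _ hP) +
    power (Dx v) (contDiffOn_Dx hv) p hd * dir (1, 0, 0) (restrict _ hP) +
      dir (1, 0, 0) (dir (1, 0, 0) (dir (1, 0, 0) (restrict _ hP)))) +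
    algebraMap ℝ _ s * dir (0, 1, 0) (dir (0, 1, 0) (restrict _ hP)))
  rw [this]
  simp only [dir_restrict]
  rfl

theorem gkpPotential_eq_ev {p s : ℝ} (hv : ContDiffOn ℝ ∞ v U)
    (hd : ∀ q ∈ U, PowerDomain p (Dx v q)) (q : U) :
    gkpPotential p s v q =
      ev q (dir (0, 0, 1) (dir (1, 0, 0) (restrict v hv)) +
        power (Dx v) (contDiffOn_Dx hv) p hd * dir (1, 0, 0) (dir (1, 0, 0) (restrict v hv)) +
        dir (1, 0, 0) (dir (1, 0, 0) (dir (1, 0, 0) (dir (1, 0, 0) (restrict v hv)))) +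
        algebraMap ℝ _ s * dir (0, 1, 0) (dir (0, 1, 0) (restrict v hv))) := by
  -- `gkpPotential` contains ∂_x∂_t, while the algebraic form of the equation contains ∂_t∂_x.
  rw [dir_comm (0, 0, 1) (1, 0, 0)]
  simp only [dir_restrict]
  rfl

end Graph

end GKP

/-! ### Sufficiency for actual solutions, and the construction of test solutions -/

namespace GKP

open TopologicalSpace

/-- The partial derivative `∂/∂x` on functions of `(x, y, t, v)`. -/
noncomputable def ddx (V : Opens Total) : Derivation ℝ (smoothAlgebra V) (smoothAlgebra V) :=
  dir (1, 0, 0, 0)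

/-- The partial derivative `∂/∂y` on functions of `(x, y, t, v)`. -/
noncomputable def ddy (V : Opens Total) : Derivation ℝ (smoothAlgebra V) (smoothAlgebra V) :=
  dir (0, 1, 0, 0)

/-- The partial derivative `∂/∂t` on functions of `(x, y, t, v)`. -/
noncomputable def ddt (V : Opens Total) : Derivation ℝ (smoothAlgebra V) (smoothAlgebra V) :=
  dir (0, 0, 1, 0)

/-- The partial derivative `∂/∂v` on functions of `(x, y, t, v)`. -/
noncomputable def ddv (V : Opens Total) : Derivation ℝ (smoothAlgebra V) (smoothAlgebra V) :=
  dir (0, 0, 0, 1)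

/-- The determining equations on an open set of `(x, y, t, v)`-space. -/
def DeterminingOn (V : Opens Total) (p s : ℝ) (ξ ζ τ η : smoothAlgebra V) : Prop :=
  Determining (ddx V) (ddy V) (ddt V) (ddv V) p s ξ ζ τ η

theorem restrict_Dx {U : Opens Base} {v : Base → ℝ} (hv : ContDiffOn ℝ ∞ v U) :
    restrict (Dx v) (contDiffOn_Dx hv) = dir (1, 0, 0) (restrict v hv) :=
  (dir_restrict _ _ _).symm

theorem DeterminingOn.isPointSymmetry {V : Opens Total} {p s : ℝ} (hp : p ≠ 0) (hs : s * s = 1)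
    {X : Generator} (hX : ContDiffOn ℝ ∞ X V)
    (h : DeterminingOn V p s (xiX hX) (xiY hX) (tau hX) (eta hX)) :
    IsPointSymmetry p s V X := by
  refine ⟨hX, fun U₀ v hsol hmaps q hq => ?_⟩
  obtain ⟨U, rfl⟩ : ∃ U : Opens Base, U₀ = (U : Set Base) := ⟨⟨U₀, hsol.isOpen⟩, rfl⟩
  rw [linearization_eq_ev_lin hX hsol.contDiffOn hmaps hsol.powerDomain ⟨q, hq⟩]
  have hv : ContDiffOn ℝ ∞ v U := hsol.contDiffOn
  have hmaps : Set.MapsTo (graphPoint v) U V := hmaps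
  have hd := hsol.powerDomain
  have hw (e : Base) : dir e (power (Dx v) (contDiffOn_Dx hv) p hd) = algebraMap ℝ _ p *
      power (Dx v) (contDiffOn_Dx hv) (p - 1) (fun q hq => (hd q hq).sub_one hp) *
      dir e (dir (1, 0, 0) (restrict v hv)) := by
    rw [← restrict_Dx hv]
    exact dir_power _ _ _ hp _
  have := (graphCalculus hv hmaps).lin_char_eq_zero hp hs h
    (power (Dx v) (contDiffOn_Dx hv) p hd)
    (power (Dx v) (contDiffOn_Dx hv) (p - 1) fun q hq => (hd q hq).sub_one hp)
    (by rw [power_eq_mul _ _ hp, restrict_Dx hv]; rfl) (hw _) (hw _) (hw _)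
    (ext_ev fun q => by
      rw [map_zero, ← hsol.equation q q.2, gkpPotential_eq_ev hv hd q]
      rfl)
    -- For p = 1 the factor v_x^(p-1) is the zeroth power, which is 1 for every base, zero included.
    (fun h1 => ext_ev fun q => by simp [power, h1])
  rw [this, map_zero]

/-- One construction supplies all test solutions through a given point z. On functions of the phase
x + ky - ct the equation reduces to φ'''' + (φ'^p + sk² - c)φ'' = 0. The map `P` pulls back along
the phase, and `Y` and `T` are the increments of y and t. -/
theorem exists_wave {p s k c f g : ℝ} (V : Opens Total) (z : V) (I : Opens ℝ) (hI : (0 : ℝ) ∈ I)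
    (φ : smoothAlgebra I) (hφ0 : ev ⟨0, hI⟩ φ = z.1.2.2.2) (hpos : ∀ r, 0 < ev r (dir 1 φ))
    (hφ : ∀ r, ev r (dir 1 (dir 1 (dir 1 (dir 1 φ)))) =
      -((ev r (dir 1 φ) ^ p + (s * k ^ 2 - c)) * ev r (dir 1 (dir 1 φ)))) :
    ∃ (U : Opens Base) (q : U) (v : Base → ℝ) (hv : ContDiffOn ℝ ∞ v U)
      (_ : Set.MapsTo (graphPoint v) U V) (hsol : IsSolutionOn p s U v)
      (P : smoothAlgebra I →ₐ[ℝ] smoothAlgebra U) (Y T : smoothAlgebra U),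
      graphPoint v q = z ∧ (∀ a, ev q (P a) = ev ⟨0, hI⟩ a) ∧
      (∀ e a, dir e (P a) = algebraMap ℝ _ (e.1 + k * e.2.1 - c * e.2.2) * P (dir 1 a)) ∧
      (∀ e, dir e (restrict v hv) = algebraMap ℝ _ (e.1 + k * e.2.1 - c * e.2.2) * P (dir 1 φ) +
        algebraMap ℝ _ e.2.1 * (algebraMap ℝ _ g * T) +
        algebraMap ℝ _ e.2.2 * (algebraMap ℝ _ f * T + algebraMap ℝ _ g * Y)) ∧
      power (Dx v) (contDiffOn_Dx hv) p hsol.powerDomain * P (dir 1 (dir 1 φ)) +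
        algebraMap ℝ _ (s * k ^ 2 - c) * P (dir 1 (dir 1 φ)) +
        P (dir 1 (dir 1 (dir 1 (dir 1 φ)))) = 0 ∧
      (∀ e, dir e Y = algebraMap ℝ _ e.2.1) ∧ (∀ e, dir e T = algebraMap ℝ _ e.2.2) ∧
      ev q Y = 0 ∧ ev q T = 0 := by
  obtain ⟨Φ, hΦ, rfl⟩ := exists_restrict φ
  obtain ⟨⟨x₀, y₀, t₀, v₀⟩, hz⟩ := z
  let L : Base →L[ℝ] ℝ := ContinuousLinearMap.fst ℝ ℝ (ℝ × ℝ) +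
    k • (ContinuousLinearMap.fst ℝ ℝ ℝ).comp (ContinuousLinearMap.snd ℝ ℝ (ℝ × ℝ)) -
    c • (ContinuousLinearMap.snd ℝ ℝ ℝ).comp (ContinuousLinearMap.snd ℝ ℝ (ℝ × ℝ))
  let m : Base → ℝ := fun q => L q - L (x₀, y₀, t₀)
  have hm : ContDiff ℝ ∞ m := L.contDiff.sub contDiff_const
  have hL (e : Base) : L e = e.1 + k * e.2.1 - c * e.2.2 := rfl
  have hm' (q e : Base) : fderiv ℝ m q e = L e := by
    simp only [m]
    rw [fderiv_sub_const, L.fderiv]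
  -- The quadratic terms contribute nothing to v_x, v_tx or v_yy, so v remains a solution, while
  -- v_tt and v_yt can be adjusted through f and g.
  let v : Base → ℝ := fun q => Φ (m q) + f / 2 * (q.2.2 - t₀) ^ 2
    + g * ((q.2.2 - t₀) * (q.2.1 - y₀))
  have hYc : ContDiff ℝ ∞ (fun q : Base => q.2.1 - y₀) :=
    (contDiff_fst.comp contDiff_snd).sub contDiff_const
  have hTc : ContDiff ℝ ∞ (fun q : Base => q.2.2 - t₀) :=
    (contDiff_snd.comp contDiff_snd).sub contDiff_const
  let U₀ : Opens Base := ⟨m ⁻¹' I, I.isOpen.preimage hm.continuous⟩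
  have hv₀ : ContDiffOn ℝ ∞ v U₀ :=
    ((hΦ.comp hm.contDiffOn fun q hq => hq).add
      (contDiff_const.mul (hTc.pow 2)).contDiffOn).add
      (contDiff_const.mul (hTc.mul hYc)).contDiffOn
  -- The domain is shrunk until the graph lies in V.
  let U : Opens Base := ⟨U₀ ∩ graphPoint v ⁻¹' V,
    (contDiffOn_graphPoint hv₀).continuousOn.isOpen_inter_preimage U₀.isOpen V.isOpen⟩
  have hv : ContDiffOn ℝ ∞ v U := hv₀.mono Set.inter_subset_left
  have hmU : Set.MapsTo m U I := fun q hq => hq.1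
  have h : Set.MapsTo (graphPoint v) U V := fun q hq => hq.2
  have hm0 : m (x₀, y₀, t₀) = 0 := sub_self _
  have hg0 : graphPoint v (x₀, y₀, t₀) = (x₀, y₀, t₀, v₀) := by
    simp only [graphPoint, v, hm0]
    simp at hφ0
    simp [hφ0]
  let q : U := ⟨(x₀, y₀, t₀), by
    refine ⟨?_, ?_⟩
    · change m _ ∈ I
      rwa [hm0]
    · change graphPoint v _ ∈ V
      rwa [hg0]⟩
  let P := pullback m hm.contDiffOn hmU
  have hP (e : Base) (a : smoothAlgebra I) : dir e (P a) = algebraMap ℝ _ (L e) * P (dir 1 a) := by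
    refine ext_ev fun q => ?_
    rw [ev_dir_pullback, hm', map_mul, AlgHom.commutes, ev_pullback,
      show L e = L e • (1 : ℝ) by simp, dir_smul, map_smul]
    simp
  have hqe (a : smoothAlgebra I) : ev q (P a) = ev ⟨0, hI⟩ a := by
    change ev ⟨m (x₀, y₀, t₀), _⟩ a = _
    congr 1
    simp [hm0]
  have L1 : L (1, 0, 0) = 1 := by simp [L]
  have L2 : L (0, 1, 0) = k := by simp [L]
  have L3 : L (0, 0, 1) = -c := by simp [L]
  let Y : smoothAlgebra U := restrict _ hYc.contDiffOn
  let T : smoothAlgebra U := restrict _ hTc.contDiffOn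
  have hY (e : Base) : dir e Y = algebraMap ℝ _ e.2.1 := by
    refine ext_ev fun q => ?_
    have h2 := (((ContinuousLinearMap.fst ℝ ℝ ℝ).comp
      (ContinuousLinearMap.snd ℝ ℝ (ℝ × ℝ))).hasFDerivAt (x := (q : Base))).sub_const y₀
    have h3 : fderiv ℝ (fun q : Base => q.2.1 - y₀) q = _ := h2.fderiv
    simp [Y, dir_restrict, h3]
  have hT (e : Base) : dir e T = algebraMap ℝ _ e.2.2 := by
    refine ext_ev fun q => ?_
    have h2 := (((ContinuousLinearMap.snd ℝ ℝ ℝ).comp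
      (ContinuousLinearMap.snd ℝ ℝ (ℝ × ℝ))).hasFDerivAt (x := (q : Base))).sub_const t₀
    have h3 : fderiv ℝ (fun q : Base => q.2.2 - t₀) q = _ := h2.fderiv
    simp [T, dir_restrict, h3]
  have hvR : restrict v hv = P (restrict Φ hΦ) + algebraMap ℝ _ (f / 2) * (T * T) +
      algebraMap ℝ _ g * (T * Y) := by
    refine ext_ev fun q => ?_
    simp only [map_add, map_mul, AlgHom.commutes]
    simp [v, P, T, Y, sq]
  have vx : dir (1, 0, 0) (restrict v hv) = P (dir 1 (restrict Φ hΦ)) := by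
    simp [hvR, hP, L1, hY, hT]
  have hpd : ∀ q ∈ U, PowerDomain p (Dx v q) := fun q hq => Or.inl (by
    have : Dx v q = ev ⟨q, hq⟩ (dir (1, 0, 0) (restrict v hv)) := by rw [← restrict_Dx]; rfl
    rw [this, vx]
    exact hpos _)
  have hpow : power (Dx v) (contDiffOn_Dx hv) p hpd *  P (dir 1 (dir 1 (restrict Φ hΦ))) +
      algebraMap ℝ _ (s * k ^ 2 - c) * P (dir 1 (dir 1 (restrict Φ hΦ))) +
      P (dir 1 (dir 1 (dir 1 (dir 1 (restrict Φ hΦ))))) = 0 := by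
    refine ext_ev fun q => ?_
    have : Dx v q = ev q (dir (1, 0, 0) (restrict v hv)) := by rw [← restrict_Dx]; rfl
    simp only [map_add, map_mul, AlgHom.commutes, power, ev_restrict, this, vx, P, ev_pullback, hφ]
    simp
    ring
  have hsol : IsSolutionOn p s U v := ⟨U.isOpen, hv, hpd, fun q hq => by
    rw [gkpPotential_eq_ev hv hpd ⟨q, hq⟩]
    refine (congrArg (ev _) (Eq.trans ?_ hpow)).trans (map_zero _)
    rw [vx, hvR]
    simp [hP, L1, hY, hT, L2, L3]
    ring⟩
  refine ⟨U, q, v, hv, h, hsol, P, Y, T, hg0, hqe, hP, fun e => ?_, hpow, hY, hT, ?_, ?_⟩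
  · have h2 : algebraMap ℝ (smoothAlgebra U) f = 2 * algebraMap ℝ (smoothAlgebra U) (f / 2) := by
      rw [← map_ofNat (algebraMap ℝ (smoothAlgebra U)) 2, ← map_mul]
      congr 1
      ring
    rw [h2, ← hL]
    simp [hvR, hP, hY, hT]
    ring
  · simp [Y, q]
  · simp [T, q]

end GKP

/-! ### Wave profiles from an ordinary differential equation -/

namespace GKP

open TopologicalSpace

theorem dir_one_restrict {I : Opens ℝ} {g h : ℝ → ℝ} (hg : ContDiffOn ℝ ∞ g I)
    (hh : ContDiffOn ℝ ∞ h I) (d : ∀ r ∈ I, HasDerivAt g (h r) r) :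
    dir 1 (restrict g hg) = restrict h hh := by
  refine ext_ev fun r => ?_
  rw [dir_restrict, ev_restrict, ev_restrict, (d r r.2).hasFDerivAt.fderiv]
  simp

/-- Local profiles of travelling waves, with prescribed initial values. -/
theorem exists_profile (p κ v₀ a b : ℝ) {u : ℝ} (hu : 0 < u) :
    ∃ (I : Opens ℝ) (hI : (0 : ℝ) ∈ I) (φ : smoothAlgebra I), ev ⟨0, hI⟩ φ = v₀ ∧
      ev ⟨0, hI⟩ (dir 1 φ) = u ∧ ev ⟨0, hI⟩ (dir 1 (dir 1 φ)) = a ∧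
      ev ⟨0, hI⟩ (dir 1 (dir 1 (dir 1 φ))) = b ∧ (∀ r, 0 < ev r (dir 1 φ)) ∧
      ∀ r, ev r (dir 1 (dir 1 (dir 1 (dir 1 φ)))) =
        -((ev r (dir 1 φ) ^ p + κ) * ev r (dir 1 (dir 1 φ))) := by
  -- The profile equation as an autonomous first-order system for (φ, φ', φ'', φ'''), smooth where
  -- φ' > 0 whatever p is.
  let N : ℝ × ℝ × ℝ × ℝ → ℝ × ℝ × ℝ × ℝ := fun y =>
    (y.2.1, y.2.2.1, y.2.2.2, -((y.2.1 ^ p + κ) * y.2.2.1))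
  let P : Set (ℝ × ℝ × ℝ × ℝ) := {y | 0 < y.2.1}
  have hP : IsOpen P := isOpen_lt continuous_const (continuous_fst.comp continuous_snd)
  have hN : ContDiffOn ℝ ∞ N P := by
    have h1 : ContDiffOn ℝ ∞ (fun y : ℝ × ℝ × ℝ × ℝ => y.2.1) P := contDiffOn_id.snd.fst
    have h2 : ContDiffOn ℝ ∞ (fun y : ℝ × ℝ × ℝ × ℝ => y.2.2.1) P := contDiffOn_id.snd.snd.fst
    have h3 : ContDiffOn ℝ ∞ (fun y : ℝ × ℝ × ℝ × ℝ => y.2.2.2) P := contDiffOn_id.snd.snd.snd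
    have h4 : ContDiffOn ℝ ∞ (fun y : ℝ × ℝ × ℝ × ℝ => y.2.1 ^ p) P :=
      h1.rpow_const_of_ne fun y hy => ne_of_gt hy
    exact h1.prodMk (h2.prodMk (h3.prodMk ((h4.add contDiffOn_const).mul h2).neg))
  have h0 : (v₀, u, a, b) ∈ P := hu
  have hN1 : ContDiffAt ℝ 1 N (v₀, u, a, b) :=
    (hN.contDiffAt (hP.mem_nhds h0)).of_le (WithTop.coe_le_coe.2 (le_top : (1 : ℕ∞) ≤ ⊤))
  obtain ⟨α, hα0, ε, hε, hα⟩ :=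
    hN1.exists_forall_mem_closedBall_exists_eq_forall_mem_Ioo_hasDerivAt₀ 0
  have hαc : ContinuousAt α 0 := (hα 0 (by simp [hε])).continuousAt
  obtain ⟨δ, hδ, hδP⟩ := Metric.mem_nhds_iff.1 (hαc.preimage_mem_nhds
    (by rw [hα0]; exact hP.mem_nhds h0))
  -- The radius is strictly smaller than both bounds because smoothness of the solution is obtained
  -- on a closed interval.
  obtain ⟨ρ, hρ, hρm⟩ := exists_between (lt_min hε hδ)
  have hρε : ρ < ε := hρm.trans_le (min_le_left _ _)
  have hρδ : ρ < δ := hρm.trans_le (min_le_right _ _)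
  have hmaps : Set.MapsTo α (Set.Icc (-ρ) ρ) P := fun r hr => hδP (by
    rw [Metric.mem_ball, Real.dist_eq, sub_zero]
    exact (abs_le.2 hr).trans_lt hρδ)
  have hαd : ∀ r ∈ Set.Icc (-ρ) ρ, HasDerivAt α (N (α r)) r := fun r hr =>
    hα r ⟨by linarith [hr.1], by linarith [hr.2]⟩
  have hαs : ContDiffOn ℝ ∞ α (Set.Icc (-ρ) ρ) :=
    ODE.contDiffOn_enat_Icc_of_hasDerivWithinAt (f := fun _ => N) (u := P) (n := ⊤)
      (hN.comp contDiffOn_snd fun z hz => hz.2) (fun r hr => (hαd r hr).hasDerivWithinAt) hmaps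
  let I : Opens ℝ := ⟨Set.Ioo (-ρ) ρ, isOpen_Ioo⟩
  have hI : (0 : ℝ) ∈ I := ⟨by linarith, hρ⟩
  have hs : ContDiffOn ℝ ∞ α I := hαs.mono Set.Ioo_subset_Icc_self
  have hd : ∀ r ∈ I, HasDerivAt α (N (α r)) r := fun r hr => hαd r (Set.Ioo_subset_Icc_self hr)
  have d1 : dir 1 (restrict _ hs.fst) = restrict _ hs.snd.fst :=
    dir_one_restrict _ _ fun r hr => (hd r hr).fst
  have d2 : dir 1 (restrict _ hs.snd.fst) = restrict _ hs.snd.snd.fst :=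
    dir_one_restrict _ _ fun r hr => (hd r hr).snd.fst
  have d3 : dir 1 (restrict _ hs.snd.snd.fst) = restrict _ hs.snd.snd.snd :=
    dir_one_restrict _ _ fun r hr => (hd r hr).snd.snd.fst
  have h4 : ContDiffOn ℝ ∞ (fun r => (N (α r)).2.2.2) I :=
    (hN.comp hs fun r hr => hmaps (Set.Ioo_subset_Icc_self hr)).snd.snd.snd
  have d4 : dir 1 (restrict _ hs.snd.snd.snd) = restrict _ h4 :=
    dir_one_restrict _ _ fun r hr => (hd r hr).snd.snd.snd
  refine ⟨I, hI, restrict _ hs.fst, ?_, ?_, ?_, ?_, ?_, ?_⟩ <;>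
    simp only [d1, d2, d3, d4, ev_restrict, hα0]
  · exact fun r => hmaps (Set.Ioo_subset_Icc_self r.2)
  · exact fun r => rfl

end GKP

/-! ### The invariance condition on the test solutions -/

namespace GKP

open TopologicalSpace

variable {V : Opens Total} {p s : ℝ} {X : Generator}

theorem IsPointSymmetry.ev_lin_eq_zero (h : IsPointSymmetry p s V X) {U : Opens Base}
    {v : Base → ℝ} (hv : ContDiffOn ℝ ∞ v U) (hm : Set.MapsTo (graphPoint v) U V)
    (hsol : IsSolutionOn p s U v) (q : U) :
    ev q ((graphCalculus hv hm).lin s (power (Dx v) (contDiffOn_Dx hv) p hsol.powerDomain)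
      ((graphCalculus hv hm).char (xiX h.contDiffOn) (xiY h.contDiffOn) (tau h.contDiffOn)
        (eta h.contDiffOn))) = 0 := by
  rw [← linearization_eq_ev_lin h.contDiffOn hv hm hsol.powerDomain]
  exact h.invariance U v hsol hm q q.2

/-- Restricting to the graph and evaluating at q is evaluation at z, so an identity on one solution
becomes a condition on the coefficients at an arbitrary point of V. -/
theorem ev_φ_eq {U : Opens Base} {v : Base → ℝ} (hv : ContDiffOn ℝ ∞ v U)
    (hm : Set.MapsTo (graphPoint v) U V) {q : U} {z : V} (hz : graphPoint v q = z) :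
    (fun a => ev q ((graphCalculus hv hm).φ a)) = ev z := by
  funext a
  obtain rfl : z = ⟨graphPoint v q, hm q.2⟩ := Subtype.ext hz.symm
  rfl

theorem IsPointSymmetry.slopeForm_eq_zero (h : IsPointSymmetry p s V X) (z : V) {u : ℝ}
    (hu : 0 < u) (f g : ℝ) :
    slopeForm (ddx V) (ddy V) (ddt V) (ddv V) (ev z) s u f g (u ^ p) (xiX h.contDiffOn)
      (xiY h.contDiffOn) (tau h.contDiffOn) (eta h.contDiffOn) = 0 := by
  -- An affine profile solves the profile equation trivially, since its second derivative is zero.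
  let φ : smoothAlgebra (⊤ : Opens ℝ) := restrict (fun r => z.1.2.2.2 + r * u)
    (contDiffOn_const.add (contDiffOn_id.mul contDiffOn_const))
  have d1 : dir 1 φ = algebraMap ℝ _ u :=
    dir_one_restrict _ contDiffOn_const fun r _ =>
      ((hasDerivAt_id r).mul_const u).const_add _ |>.congr_deriv (one_mul u)
  obtain ⟨U, q, v, hv, hm, hsol, P, Y, T, hz, hP, dP, dv, -, dY, dT, eY, eT⟩ :=
    exists_wave (p := p) (s := s) (k := 0) (c := 0) (f := f) (g := g) V z ⊤ trivial φ
      (by simp [φ]) (fun r => by simp [d1, hu]) (fun r => by simp [d1])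
  have hw : power (Dx v) (contDiffOn_Dx hv) p hsol.powerDomain = algebraMap ℝ _ (u ^ p) := by
    refine ext_ev fun r => ?_
    have : Dx v r = ev r (dir (1, 0, 0) (restrict v hv)) := by rw [← restrict_Dx]; rfl
    simp [power, this, dv, d1]
  have key := h.ev_lin_eq_zero hv hm hsol q
  rw [hw, GraphCalculus.lin_char_of_slope (u := u) (f := f) (g := g)
    (g' := algebraMap ℝ _ g * T) (f' := algebraMap ℝ _ f * T + algebraMap ℝ _ g * Y),
    ev_φ_eq hv hm hz] at key
  · exact key
  · exact (dv _).trans (by simp [d1])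
  · exact (dv _).trans (by simp [d1])
  · exact (dv _).trans (by simp [d1])
  all_goals simp [graphCalculus, dT, dY, eY, eT]

theorem IsPointSymmetry.stationaryForm_eq_zero (h : IsPointSymmetry p s V X) (hp : p ≠ 0) (z : V)
    {u : ℝ} (hu : 0 < u) (a b : ℝ) :
    stationaryForm (ddx V) (ddy V) (ddt V) (ddv V) (ev z) p s u a b (u ^ p) (u ^ (p - 1))
      (xiX h.contDiffOn) (eta h.contDiffOn) = 0 := by
  obtain ⟨I, hI, φ, e0, e1, e2, e3, hpos, hφ⟩ := exists_profile p (s * 0 ^ 2 - 0) z.1.2.2.2 a b hu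
  obtain ⟨U, q, v, hv, hm, hsol, P, Y, T, hz, hP, dP, dv, hE, dY, dT, eY, eT⟩ :=
    exists_wave (p := p) (s := s) (k := 0) (c := 0) (f := 0) (g := 0) V z I hI φ e0 hpos hφ
  have vx : dir (1, 0, 0) (restrict v hv) = P (dir 1 φ) := (dv _).trans (by simp)
  have hDx : Dx v q = u := by
    have : Dx v q = ev q (dir (1, 0, 0) (restrict v hv)) := by rw [← restrict_Dx]; rfl
    rw [this, vx, hP, e1]
  have hwx := dir_power (1, 0, 0) _ (contDiffOn_Dx hv) hp hsol.powerDomain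
  rw [restrict_Dx hv, vx, dP] at hwx
  have key := h.ev_lin_eq_zero hv hm hsol q
  rw [GraphCalculus.lin_char_of_stationary (p := p) (u := u) (a := a) (b := b) (W := u ^ p)
    (W₁ := u ^ (p - 1)) (F₁ := P (dir 1 φ)) (F₂ := P (dir 1 (dir 1 φ)))
    (F₃ := P (dir 1 (dir 1 (dir 1 φ))))
    (w₁ := power (Dx v) (contDiffOn_Dx hv) (p - 1) fun q hq => (hsol.powerDomain q hq).sub_one hp),
    ev_φ_eq hv hm hz] at key
  · exact key
  · exact vx
  · exact (dv _).trans (by simp)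
  · exact (dv _).trans (by simp)
  · exact (dP _ _).trans (by simp)
  · exact (dP _ _).trans (by simp)
  · exact (dP _ _).trans (by simp)
  · exact (dP _ _).trans (by simp)
  · refine (dP _ _).trans ?_
    simp at hE ⊢
    linear_combination hE
  · exact hwx.trans (by simp)
  · rw [hP, e1]
  · rw [hP, e2]
  · rw [hP, e3]
  · simp [power, hDx]
  · simp [power, hDx]

theorem IsPointSymmetry.waveForm_eq_zero (h : IsPointSymmetry p s V X) (hp : p ≠ 0)
    (τx : ddx V (tau h.contDiffOn) = 0) (τv : ddv V (tau h.contDiffOn) = 0)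
    (ζv : ddv V (xiY h.contDiffOn) = 0) (ξv : ddv V (xiX h.contDiffOn) = 0)
    (ηvv : ddv V (ddv V (eta h.contDiffOn)) = 0) (ζx : ddx V (ddx V (xiY h.contDiffOn)) = 0)
    (ηxv : algebraMap ℝ _ 2 * ddx V (ddv V (eta h.contDiffOn)) =
      algebraMap ℝ _ 3 * ddx V (ddx V (xiX h.contDiffOn)))
    (z : V) {u : ℝ} (hu : 0 < u) (k c a : ℝ) :
    waveForm (ddx V) (ddy V) (ddt V) (ddv V) (ev z) p s k c u a (u ^ p) (u ^ (p - 1))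
      (xiX h.contDiffOn) (xiY h.contDiffOn) (tau h.contDiffOn) (eta h.contDiffOn) = 0 := by
  -- The initial third derivative may be taken to be 0, as it does not enter `waveForm`.
  obtain ⟨I, hI, φ, e0, e1, e2, e3, hpos, hφ⟩ := exists_profile p (s * k ^ 2 - c) z.1.2.2.2 a 0 hu
  obtain ⟨U, q, v, hv, hm, hsol, P, Y, T, hz, hP, dP, dv, hE, dY, dT, eY, eT⟩ :=
    exists_wave (p := p) (s := s) (k := k) (c := c) (f := 0) (g := 0) V z I hI φ e0 hpos hφ
  have vx : dir (1, 0, 0) (restrict v hv) = P (dir 1 φ) := (dv _).trans (by simp)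
  have hDx : Dx v q = u := by
    have : Dx v q = ev q (dir (1, 0, 0) (restrict v hv)) := by rw [← restrict_Dx]; rfl
    rw [this, vx, hP, e1]
  have hwx := dir_power (1, 0, 0) _ (contDiffOn_Dx hv) hp hsol.powerDomain
  rw [restrict_Dx hv, vx, dP] at hwx
  have key := h.ev_lin_eq_zero hv hm hsol q
  rw [GraphCalculus.lin_char_of_wave (p := p) (k := k) (c := c) (u := u) (a := a) (b := 0)
    (W := u ^ p) (W₁ := u ^ (p - 1)) (F₁ := P (dir 1 φ)) (F₂ := P (dir 1 (dir 1 φ)))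
    (F₃ := P (dir 1 (dir 1 (dir 1 φ))))
    (w₁ := power (Dx v) (contDiffOn_Dx hv) (p - 1) fun q hq => (hsol.powerDomain q hq).sub_one hp),
    ev_φ_eq hv hm hz] at key
  · exact key
  · exact τx
  · exact τv
  · exact ζv
  · exact ξv
  · exact ηvv
  · exact ζx
  · exact ηxv
  · exact vx
  · exact (dv _).trans (by simp)
  · exact (dv _).trans (by simp)
  · exact (dP _ _).trans (by simp)
  · exact (dP _ _).trans (by simp)
  · exact (dP _ _).trans (by simp)
  · exact (dP _ _).trans (by simp)
  · exact (dP _ _).trans (by simp)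
  · refine (dP _ _).trans ?_
    simp at hE ⊢
    linear_combination hE
  · exact hwx.trans (by simp)
  · rw [hP, e1]
  · rw [hP, e2]
  · rw [hP, e3]
  · simp [power, hDx]
  · simp [power, hDx]

end GKP

/-! ### Necessity of the determining equations -/

namespace GKP

open TopologicalSpace

variable {V : Opens Total} {p s : ℝ}

theorem ddx_ddt (a : smoothAlgebra V) : ddx V (ddt V a) = ddt V (ddx V a) := dir_comm _ _ _
theorem ddx_ddy (a : smoothAlgebra V) : ddx V (ddy V a) = ddy V (ddx V a) := dir_comm _ _ _
theorem ddy_ddt (a : smoothAlgebra V) : ddy V (ddt V a) = ddt V (ddy V a) := dir_comm _ _ _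
theorem ddy_ddv (a : smoothAlgebra V) : ddy V (ddv V a) = ddv V (ddy V a) := dir_comm _ _ _
theorem ddt_ddv (a : smoothAlgebra V) : ddt V (ddv V a) = ddv V (ddt V a) := dir_comm _ _ _

/-- A linear relation between the functions `u ^ (p - 1)`, `u ^ p` and `1`. -/
theorem eq_zero_of_power_relation {p α β γ : ℝ} (hp : p ≠ 0)
    (h : ∀ u : ℝ, 0 < u → α * u ^ (p - 1) + β * u ^ p = γ) :
    (p = 1 ∧ β = 0 ∧ α = γ) ∨ (p ≠ 1 ∧ α = 0 ∧ β = 0 ∧ γ = 0) := by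
  -- Three samples suffice. With x = 2^p they form a linear system in α, β, γ, which is
  -- nondegenerate if x differs from 0, 1 and 2; this holds for p ≠ 0, 1.
  have h1 := h 1 one_pos
  have h2 := h 2 two_pos
  have h4 := h 4 four_pos
  rw [Real.one_rpow, Real.one_rpow] at h1
  have e4 (r : ℝ) : (4 : ℝ) ^ r = 2 ^ r * 2 ^ r := by
    rw [← Real.mul_rpow zero_le_two zero_le_two]; norm_num
  have e2 : (2 : ℝ) ^ (p - 1) = 2 ^ p / 2 := Real.rpow_sub_one two_ne_zero p
  rw [e4, e4, e2] at h4
  rw [e2] at h2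
  have hpos : (0 : ℝ) < 2 ^ p := Real.rpow_pos_of_pos two_pos p
  obtain ⟨x, hx⟩ : ∃ x : ℝ, x = 2 ^ p := ⟨_, rfl⟩
  rw [← hx] at h2 h4 hpos
  by_cases hp1 : p = 1
  · have : x = 2 := by rw [hx, hp1, Real.rpow_one]
    subst this
    exact Or.inl ⟨hp1, by linarith, by linarith⟩
  · have hx1 : x - 1 ≠ 0 := fun h0 => hp (by
      have : (2 : ℝ) ^ p = 2 ^ (0 : ℝ) := by rw [Real.rpow_zero]; linarith
      exact (Real.rpow_right_inj two_pos (by norm_num)).1 this)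
    have hx2 : x - 2 ≠ 0 := fun h0 => hp1 (by
      have : (2 : ℝ) ^ p = 2 ^ (1 : ℝ) := by rw [Real.rpow_one]; linarith
      exact (Real.rpow_right_inj two_pos (by norm_num)).1 this)
    have hβ : β = 0 := by
      have : β * (x * (x - 1)) = 0 := by
        linear_combination 2 * (h4 - h1 - (x / 2 + 1) * (h2 - h1))
      simpa [hpos.ne', hx1] using this
    subst hβ
    have hα : α = 0 := by
      have : α * (x - 2) = 0 := by linear_combination 2 * (h2 - h1)
      simpa [hx2] using this
    exact Or.inr ⟨hp1, hα, rfl, by linarith⟩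

-- Each form is polynomial in the free parameters f, g, a, b, k, c, so finite differences in them
-- isolate single coefficients; every rational factor below normalizes such a difference. The third
-- hypothesis is conditional because `waveForm` is the value of the operator only after the
-- equations from the first two forms are known.
set_option maxHeartbeats 2000000 in
theorem determiningOn_of_forms (hp : p ≠ 0) (hs : s * s = 1) (ξ ζ τ η : smoothAlgebra V)
    (H₁ : ∀ (z : V) (u : ℝ), 0 < u → ∀ f g : ℝ, slopeForm (ddx V) (ddy V) (ddt V) (ddv V) (ev z)
      s u f g (u ^ p) ξ ζ τ η = 0)
    (H₂ : ∀ (z : V) (u : ℝ), 0 < u → ∀ a b : ℝ, stationaryForm (ddx V) (ddy V) (ddt V) (ddv V)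
      (ev z) p s u a b (u ^ p) (u ^ (p - 1)) ξ η = 0)
    (H₃ : ddx V τ = 0 → ddv V τ = 0 → ddv V ζ = 0 → ddv V ξ = 0 → ddv V (ddv V η) = 0 →
      ddx V (ddx V ζ) = 0 →
      algebraMap ℝ _ 2 * ddx V (ddv V η) = algebraMap ℝ _ 3 * ddx V (ddx V ξ) →
      ∀ (z : V) (u : ℝ), 0 < u → ∀ k c a : ℝ, waveForm (ddx V) (ddy V) (ddt V) (ddv V) (ev z)
        p s k c u a (u ^ p) (u ^ (p - 1)) ξ ζ τ η = 0) :
    DeterminingOn V p s ξ ζ τ η := by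
  have hs0 : s ≠ 0 := fun h => by simp [h] at hs
  have τv : ddv V τ = 0 := ext_ev fun z => by
    have h1 := H₁ z 1 one_pos 1 0
    have h2 := H₁ z 1 one_pos 0 0
    have h3 := H₁ z 2 two_pos 1 0
    have h4 := H₁ z 2 two_pos 0 0
    simp only [slopeForm] at h1 h2 h3 h4
    rw [map_zero]
    linear_combination h1 - h2 - h3 + h4
  have τx : ddx V τ = 0 := ext_ev fun z => by
    have h1 := H₁ z 1 one_pos 1 0
    have h2 := H₁ z 1 one_pos 0 0
    simp only [slopeForm, τv, map_zero] at h1 h2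
    rw [map_zero]
    linear_combination h2 - h1
  have ζv : ddv V ζ = 0 := ext_ev fun z => by
    have h1 := H₁ z 1 one_pos 0 1
    have h2 := H₁ z 1 one_pos 0 0
    have h3 := H₁ z 2 two_pos 0 1
    have h4 := H₁ z 2 two_pos 0 0
    simp only [slopeForm] at h1 h2 h3 h4
    rw [map_zero]
    linear_combination h1 - h2 - h3 + h4
  have ζxτ : ddx V ζ + algebraMap ℝ _ (2 * s) * ddy V τ = 0 := ext_ev fun z => by
    have h1 := H₁ z 1 one_pos 0 1
    have h2 := H₁ z 1 one_pos 0 0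
    simp only [slopeForm, ζv, map_zero] at h1 h2
    simp only [map_zero, map_add, map_mul, AlgHom.commutes, Algebra.algebraMap_self,
      RingHom.id_apply]
    linear_combination h2 - h1
  clear H₁
  have ξv : ddv V ξ = 0 := ext_ev fun z => by
    have h1 := H₂ z 1 one_pos 1 1
    have h2 := H₂ z 1 one_pos 1 (-1)
    have h3 := H₂ z 1 one_pos (-1) 1
    have h4 := H₂ z 1 one_pos (-1) (-1)
    simp only [stationaryForm] at h1 h2 h3 h4
    rw [map_zero]
    -- The mixed difference retains only the term -10 ξ_v ab, four times.
    linear_combination -(1 / 40) * (h1 - h2 - h3 + h4)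
  simp only [stationaryForm, ξv, map_zero] at H₂
  have ηvv : ddv V (ddv V η) = 0 := ext_ev fun z => by
    have h1 := H₂ z 1 one_pos 1 0
    have h2 := H₂ z 1 one_pos (-1) 0
    have h3 := H₂ z 1 one_pos 0 0
    rw [map_zero]
    linear_combination (1 / 6) * (h1 + h2 - 2 * h3)
  have ηxv : algebraMap ℝ _ 2 * ddx V (ddv V η) = algebraMap ℝ _ 3 * ddx V (ddx V ξ) :=
    ext_ev fun z => by
      have h1 := H₂ z 1 one_pos 0 1
      have h2 := H₂ z 1 one_pos 0 0
      simp only [ηvv, map_zero] at h1 h2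
      simp only [map_mul, AlgHom.commutes, Algebra.algebraMap_self, RingHom.id_apply]
      linear_combination (1 / 2) * (h1 - h2)
  clear H₂
  -- The x-derivative of ζ_x = -2sτ_y, with τ_x = 0.
  have ζxx : ddx V (ddx V ζ) = 0 := by
    have := congrArg (ddx V) ζxτ
    simpa only [map_add, Derivation.leibniz, smul_eq_mul, ddx_ddy, τx, map_zero, mul_zero,
      Derivation.map_algebraMap, add_zero] using this
  replace H₃ := H₃ τx τv ζv ξv ηvv ζxx ηxv
  simp only [waveForm] at H₃
  have ζx : ddx V ζ = 0 := ext_ev fun z => by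
    have e (k : ℝ) := (H₃ z 1 one_pos k 0 1)
    have e' (k : ℝ) := (H₃ z 1 one_pos k 0 (-1))
    have : 4 * s * ev z (ddx V ζ) = 0 := by
      -- The coefficient of ak³ is 4sζ_x. A third difference with step 2 multiplies it by 48, and
      -- the difference in a by 2.
      linear_combination (1 / 96) * ((e 3 - e' 3) - 3 * (e 1 - e' 1) + 3 * (e (-1) - e' (-1))
        - (e (-3) - e' (-3)))
    simpa [hs0] using this
  have τy : ddy V τ = 0 := ext_ev fun z => by
    have := congrArg (ev z) ζxτ
    simpa [ζx, hs0] using this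
  simp only [ζx, τy, map_zero] at H₃
  have ξx : ddx V ξ = algebraMap ℝ _ (1 / 3) * ddt V τ := ext_ev fun z => by
    have e (c : ℝ) := (H₃ z 1 one_pos 0 c 1)
    have e' (c : ℝ) := (H₃ z 1 one_pos 0 c (-1))
    simp only [map_mul, AlgHom.commutes, Algebra.algebraMap_self, RingHom.id_apply]
    linear_combination (-1 / 6) * ((e 1 - e' 1) - (e 0 - e' 0))
  have ξxx : ddx V (ddx V ξ) = 0 := by
    rw [ξx]
    simp only [Derivation.leibniz, smul_eq_mul, ddx_ddt, τx, map_zero, mul_zero,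
      Derivation.map_algebraMap, add_zero]
  have ηxv0 : ddx V (ddv V η) = 0 := ext_ev fun z => by
    have := congrArg (ev z) ηxv
    simpa [ξxx] using this
  simp only [ξxx, ηxv0, map_zero] at H₃
  have ζy' : ∀ z, ev z (ddy V ζ) = 2 * ev z (ddx V ξ) := fun z => by
    have e (k : ℝ) := (H₃ z 1 one_pos k 0 1)
    have e' (k : ℝ) := (H₃ z 1 one_pos k 0 (-1))
    linear_combination (-s / 8) * ((e 1 - e' 1) + (e (-1) - e' (-1)) - 2 * (e 0 - e' 0)) +
      (2 * ev z (ddx V ξ) - ev z (ddy V ζ)) * hs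
  have ζy : ddy V ζ = algebraMap ℝ _ (2 / 3) * ddt V τ := ext_ev fun z => by
    rw [ζy', ξx]
    simp only [map_mul, AlgHom.commutes, Algebra.algebraMap_self, RingHom.id_apply]
    ring
  have ζt : ddt V ζ = algebraMap ℝ _ (-2 * s) * ddy V ξ := ext_ev fun z => by
    have e (k : ℝ) := (H₃ z 1 one_pos k 0 1)
    have e' (k : ℝ) := (H₃ z 1 one_pos k 0 (-1))
    simp only [map_mul, AlgHom.commutes, Algebra.algebraMap_self, RingHom.id_apply]
    linear_combination (-1 / 4) * ((e 1 - e' 1) - (e (-1) - e' (-1)))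
  -- The coefficient of a at k = c = 0 is a relation between u^(p-1), u^p and 1 for all u > 0. Only
  -- here does p = 1 separate from the other exponents.
  have rel : ∀ z, (p = 1 ∧ p * (ev z (ddv V η) - ev z (ddx V ξ)) + 2 * ev z (ddx V ξ) = 0 ∧
        p * ev z (ddx V η) = ev z (ddt V ξ)) ∨
      (p ≠ 1 ∧ p * ev z (ddx V η) = 0 ∧
        p * (ev z (ddv V η) - ev z (ddx V ξ)) + 2 * ev z (ddx V ξ) = 0 ∧
        ev z (ddt V ξ) = 0) := fun z => by
    refine eq_zero_of_power_relation hp fun u hu => ?_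
    have e := H₃ z u hu 0 0 1
    have e' := H₃ z u hu 0 0 (-1)
    have hu' : u ^ p = u ^ (p - 1) * u := rpow_eq_rpow_sub_one_mul hp (Or.inl hu)
    rw [hu'] at e e' ⊢
    linear_combination (1 / 2) * (e - e')
  have ηv : ddv V η = algebraMap ℝ _ ((1 - 2 / p) / 3) * ddt V τ := ext_ev fun z => by
    have h1 : p * (ev z (ddv V η) - ev z (ddx V ξ)) + 2 * ev z (ddx V ξ) = 0 := by
      rcases rel z with h | h
      · exact h.2.1
      · exact h.2.2.1
    rw [ξx] at h1
    simp only [map_mul, AlgHom.commutes, Algebra.algebraMap_self, RingHom.id_apply] at h1 ⊢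
    field_simp
    linear_combination 3 * h1
  have alt : (p = 1 ∧ ddx V η = ddt V ξ) ∨ (ddx V η = 0 ∧ ddt V ξ = 0) := by
    by_cases hp1 : p = 1
    · refine Or.inl ⟨hp1, ext_ev fun z => ?_⟩
      rcases rel z with h | h
      · simpa [hp1] using h.2.2
      · exact absurd hp1 h.1
    · refine Or.inr ⟨ext_ev fun z => ?_, ext_ev fun z => ?_⟩
      · rcases rel z with h | h
        · exact absurd h.1 hp1
        · simpa [hp] using h.2.1
      · rcases rel z with h | h
        · exact absurd h.1 hp1
        · simpa using h.2.2.2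
  refine ⟨τx, τy, τv, ζx, ζv, ξv, ξx, ζy, ζt, ηv, ext_ev fun z => ?_, alt⟩
  have e1 := H₃ z 1 one_pos 0 0 0
  have e2 := H₃ z 2 two_pos 0 0 0
  simp only [map_zero, map_add, map_mul, AlgHom.commutes, Algebra.algebraMap_self,
      RingHom.id_apply]
  rcases alt with ⟨rfl, ηx⟩ | ⟨ηx, -⟩
  · have ηxxx : ddx V (ddt V (ddx V ξ)) = 0 := by rw [ddx_ddt, ξxx, map_zero]
    simp only [ηx, ddx_ddt ξ, ηxxx, map_zero, Real.rpow_one] at e1 e2 ⊢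
    -- At a = 0 the form is affine in u here, because for p = 1 the term u^p η_xx is linear in u.
    -- Hence this combination is its value at u = 0, namely η_tx + sη_yy.
    linear_combination 2 * e1 - e2
  · simp only [ηx, map_zero] at e1 e2 ⊢
    linear_combination 2 * e1 - e2

theorem IsPointSymmetry.determiningOn {X : Generator} (h : IsPointSymmetry p s V X) (hp : p ≠ 0)
    (hs : s * s = 1) :
    DeterminingOn V p s (xiX h.contDiffOn) (xiY h.contDiffOn) (tau h.contDiffOn)
      (eta h.contDiffOn) :=
  determiningOn_of_forms hp hs _ _ _ _ (fun z _ hu => h.slopeForm_eq_zero z hu)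
    (fun z _ hu => h.stationaryForm_eq_zero hp z hu)
    (fun h1 h2 h3 h4 h5 h6 h7 z _ hu => h.waveForm_eq_zero hp h1 h2 h3 h4 h5 h6 h7 z hu)

end GKP

/-! ### Functions of t alone on a convex domain, and coordinates -/

namespace GKP

open TopologicalSpace

variable {V : Opens Total}

theorem dir_eq (e : Total) (a : smoothAlgebra V) :
    dir e a = e.1 • ddx V a + e.2.1 • ddy V a + e.2.2.1 • ddt V a + e.2.2.2 • ddv V a := by
  have : e = e.1 • (1, 0, 0, 0) + e.2.1 • (0, 1, 0, 0) + e.2.2.1 • (0, 0, 1, 0) +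
      e.2.2.2 • (0, 0, 0, 1) := by
    ext <;> simp
  conv_lhs => rw [this]
  simp only [dir_add, dir_smul]
  rfl

/-- The line through z and z' meets the convex set V in an open interval of parameters, on which the
derivative of a along the line is zero. -/
theorem ev_eq_of_dir_eq_zero (hV : Convex ℝ (V : Set Total)) (a : smoothAlgebra V) (z z' : V)
    (h : dir ((z' : Total) - z) a = 0) : ev z a = ev z' a := by
  obtain ⟨g, hg, rfl⟩ := exists_restrict a
  rw [dir_restrict] at h
  let ℓ : ℝ → Total := fun r => (z : Total) + r • ((z' : Total) - z)
  have hℓ : Continuous ℓ := by fun_prop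
  have hd (r : ℝ) : HasDerivAt ℓ ((z' : Total) - z) r :=
    (((hasDerivAt_id r).smul_const ((z' : Total) - z)).const_add (z : Total)).congr_deriv
      (one_smul ℝ _)
  have ho : IsOpen (ℓ ⁻¹' V) := V.isOpen.preimage hℓ
  have hc : Convex ℝ (ℓ ⁻¹' V) := by
    intro r hr r' hr' α β hα hβ hab
    have : ℓ (α • r + β • r') = α • ℓ r + β • ℓ r' := by
      simp only [ℓ, smul_eq_mul]
      match_scalars <;> linarith
    rw [Set.mem_preimage, this]
    exact hV hr hr' hα hβ hab
  have hD (r : ℝ) (hr : r ∈ ℓ ⁻¹' V) : HasDerivAt (g ∘ ℓ) 0 r := by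
    have h1 := (differentiableAt_of_contDiffOn hg ⟨ℓ r, hr⟩).hasFDerivAt.comp_hasDerivAt r (hd r)
    have h2 := congrArg (ev ⟨ℓ r, hr⟩) h
    rw [map_zero, ev_restrict] at h2
    exact h1.congr_deriv h2
  have := ho.is_const_of_deriv_eq_zero hc.isPreconnected
    (fun r hr => (hD r hr).differentiableAt.differentiableWithinAt) (fun r hr => (hD r hr).deriv)
    (x := 0) (y := 1) (by simp [ℓ]) (by simp [ℓ])
  simpa [ℓ] using this

theorem exists_eq_algebraMap (hV : Convex ℝ (V : Set Total)) (hn : (V : Set Total).Nonempty)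
    (a : smoothAlgebra V) (hx : ddx V a = 0) (hy : ddy V a = 0) (ht : ddt V a = 0)
    (hv : ddv V a = 0) : ∃ c : ℝ, a = algebraMap ℝ _ c := by
  obtain ⟨z₀, hz₀⟩ := hn
  refine ⟨ev ⟨z₀, hz₀⟩ a, ext_ev fun z => ?_⟩
  rw [AlgHom.commutes]
  exact ev_eq_of_dir_eq_zero hV a _ _ (by rw [dir_eq, hx, hy, ht, hv]; simp)

theorem isOpen_timeSet (V : Opens Total) : IsOpen (timeSet V) :=
  isOpenMap_fst.comp (isOpenMap_snd.comp isOpenMap_snd) _ V.isOpen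

theorem mem_timeSet (z : V) : z.1.2.2.1 ∈ timeSet V := ⟨z, z.2, rfl⟩

theorem contDiffOn_deriv_timeSet {f : ℝ → ℝ} (hf : ContDiffOn ℝ ∞ f (timeSet V)) :
    ContDiffOn ℝ ∞ (deriv f) (timeSet V) :=
  ((contDiffOn_infty_iff_deriv_of_isOpen (isOpen_timeSet V)).1 hf).2

/-- A function of `t` as a function of `(x, y, t, v)`. -/
noncomputable def timeFun (f : ℝ → ℝ) (hf : ContDiffOn ℝ ∞ f (timeSet V)) : smoothAlgebra V :=
  restrict (fun z => f z.2.2.1) (hf.comp contDiffOn_id.snd.snd.fst fun z hz => ⟨z, hz, rfl⟩)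

@[simp] theorem ev_timeFun (f : ℝ → ℝ) (hf : ContDiffOn ℝ ∞ f (timeSet V)) (z : V) :
    ev z (timeFun f hf) = f z.1.2.2.1 := rfl

theorem dir_timeFun (f : ℝ → ℝ) (hf : ContDiffOn ℝ ∞ f (timeSet V)) (e : Total) :
    dir e (timeFun f hf) = e.2.2.1 • timeFun (deriv f) (contDiffOn_deriv_timeSet hf) := by
  refine ext_ev fun z => ?_
  have h1 : DifferentiableAt ℝ f z.1.2.2.1 :=
    (hf.contDiffAt ((isOpen_timeSet V).mem_nhds (mem_timeSet z))).differentiableAt (by simp)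
  have h2 := h1.hasDerivAt.comp_hasFDerivAt (z : Total)
    ((hasFDerivAt_id (𝕜 := ℝ) (z : Total)).snd.snd.fst)
  have h3 : fderiv ℝ (fun z : Total => f z.2.2.1) z = _ := h2.fderiv
  rw [timeFun, dir_restrict, ev_restrict, h3, map_smul, ev_timeFun]
  simp [mul_comm]

theorem timeFun_eq_iff {f g : ℝ → ℝ} {hf : ContDiffOn ℝ ∞ f (timeSet V)}
    {hg : ContDiffOn ℝ ∞ g (timeSet V)} :
    timeFun f hf = timeFun g hg ↔ Set.EqOn f g (timeSet V) := by
  refine ⟨?_, fun h => ext_ev fun z => h (mem_timeSet z)⟩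
  rintro h _ ⟨z, hz, rfl⟩
  exact congrArg (ev ⟨z, hz⟩) h

/-- Two points of V with equal t are joined by a segment in V along which t is constant, so a takes
one value on each slice. Convexity is essential: a disconnected slice could carry several values. -/
theorem exists_timeFun (hV : Convex ℝ (V : Set Total)) (a : smoothAlgebra V) (hx : ddx V a = 0)
    (hy : ddy V a = 0) (hv : ddv V a = 0) :
    ∃ (f : ℝ → ℝ) (hf : ContDiffOn ℝ ∞ f (timeSet V)), a = timeFun f hf := by
  have hconst (z z' : V) (h : z.1.2.2.1 = z'.1.2.2.1) : ev z a = ev z' a :=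
    ev_eq_of_dir_eq_zero hV a _ _ (by rw [dir_eq, hx, hy, hv]; simp [h])
  have hch : ∀ t : ℝ, ∃ c : ℝ, ∀ z : V, z.1.2.2.1 = t → ev z a = c := fun t => by
    by_cases h : ∃ z : V, z.1.2.2.1 = t
    · obtain ⟨z, hz⟩ := h
      exact ⟨ev z a, fun z' h' => hconst z' z (h'.trans hz.symm)⟩
    · exact ⟨0, fun z hz => absurd ⟨z, hz⟩ h⟩
  choose f hf using hch
  obtain ⟨g, hg, rfl⟩ := exists_restrict a
  refine ⟨f, ?_, ext_ev fun z => hf _ z rfl⟩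
  rintro _ ⟨z, hz, rfl⟩
  -- Smoothness is local: near the given time f is a restricted to the line through z on which only
  -- t varies.
  let m : ℝ → Total := fun t => (z.1, z.2.1, t, z.2.2.2)
  have hm : ContDiff ℝ ∞ m :=
    contDiff_const.prodMk (contDiff_const.prodMk (contDiff_id.prodMk contDiff_const))
  have h1 : ContDiffAt ℝ ∞ (g ∘ m) z.2.2.1 :=
    (hg.contDiffAt (V.isOpen.mem_nhds hz)).comp z.2.2.1 hm.contDiffAt
  refine (h1.congr_of_eventuallyEq ?_).contDiffWithinAt
  filter_upwards [hm.continuous.continuousAt.preimage_mem_nhds (V.isOpen.mem_nhds hz)] with t ht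
  exact (hf t ⟨m t, ht⟩ rfl).symm

/-- The coordinate function `x`. -/
noncomputable def coordX (V : Opens Total) : smoothAlgebra V :=
  restrict (fun z => z.1) contDiffOn_id.fst

/-- The coordinate `y` on an open set. -/
noncomputable def coordY (V : Opens Total) : smoothAlgebra V :=
  restrict (fun z => z.2.1) contDiffOn_id.snd.fst

/-- The coordinate `t` on an open set. -/
noncomputable def coordT (V : Opens Total) : smoothAlgebra V :=
  restrict (fun z => z.2.2.1) contDiffOn_id.snd.snd.fst

/-- The coordinate `v` on an open set. -/
noncomputable def coordV (V : Opens Total) : smoothAlgebra V :=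
  restrict (fun z => z.2.2.2) contDiffOn_id.snd.snd.snd

theorem dir_restrict_clm (L : Total →L[ℝ] ℝ) (h : ContDiffOn ℝ ∞ L V) (e : Total) :
    dir e (restrict L h) = algebraMap ℝ _ (L e) := by
  refine ext_ev fun z => ?_
  rw [dir_restrict, ev_restrict, L.fderiv, AlgHom.commutes]
  rfl

theorem dir_coordX (e : Total) : dir e (coordX V) = algebraMap ℝ _ e.1 :=
  dir_restrict_clm (ContinuousLinearMap.fst ℝ ℝ (ℝ × ℝ × ℝ)) _ e

theorem dir_coordY (e : Total) : dir e (coordY V) = algebraMap ℝ _ e.2.1 :=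
  dir_restrict_clm ((ContinuousLinearMap.fst ℝ ℝ (ℝ × ℝ)).comp
    (ContinuousLinearMap.snd ℝ ℝ (ℝ × ℝ × ℝ))) _ e

theorem dir_coordT (e : Total) : dir e (coordT V) = algebraMap ℝ _ e.2.2.1 :=
  dir_restrict_clm (((ContinuousLinearMap.fst ℝ ℝ ℝ).comp
    (ContinuousLinearMap.snd ℝ ℝ (ℝ × ℝ))).comp (ContinuousLinearMap.snd ℝ ℝ (ℝ × ℝ × ℝ))) _ e

theorem dir_coordV (e : Total) : dir e (coordV V) = algebraMap ℝ _ e.2.2.2 :=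
  dir_restrict_clm (((ContinuousLinearMap.snd ℝ ℝ ℝ).comp
    (ContinuousLinearMap.snd ℝ ℝ (ℝ × ℝ))).comp (ContinuousLinearMap.snd ℝ ℝ (ℝ × ℝ × ℝ))) _ e

@[simp] theorem ev_coordX (z : V) : ev z (coordX V) = z.1.1 := rfl
@[simp] theorem ev_coordY (z : V) : ev z (coordY V) = z.1.2.1 := rfl
@[simp] theorem ev_coordT (z : V) : ev z (coordT V) = z.1.2.2.1 := rfl
@[simp] theorem ev_coordV (z : V) : ev z (coordV V) = z.1.2.2.2 := rfl

section Coordinates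

variable (f : ℝ → ℝ) (hf : ContDiffOn ℝ ∞ f (timeSet V))

theorem ddx_timeFun : ddx V (timeFun f hf) = 0 := (dir_timeFun f hf _).trans (zero_smul _ _)
theorem ddy_timeFun : ddy V (timeFun f hf) = 0 := (dir_timeFun f hf _).trans (zero_smul _ _)
theorem ddv_timeFun : ddv V (timeFun f hf) = 0 := (dir_timeFun f hf _).trans (zero_smul _ _)
theorem ddt_timeFun :
    ddt V (timeFun f hf) = timeFun (deriv f) (contDiffOn_deriv_timeSet hf) :=
  (dir_timeFun f hf _).trans (one_smul _ _)

theorem partials_coordX :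
    ddx V (coordX V) = 1 ∧ ddy V (coordX V) = 0 ∧
      ddt V (coordX V) = 0 ∧ ddv V (coordX V) = 0 :=
  ⟨(dir_coordX _).trans (map_one _), (dir_coordX _).trans (map_zero _),
    (dir_coordX _).trans (map_zero _), (dir_coordX _).trans (map_zero _)⟩

theorem partials_coordY :
    ddx V (coordY V) = 0 ∧ ddy V (coordY V) = 1 ∧
      ddt V (coordY V) = 0 ∧ ddv V (coordY V) = 0 :=
  ⟨(dir_coordY _).trans (map_zero _), (dir_coordY _).trans (map_one _),
    (dir_coordY _).trans (map_zero _), (dir_coordY _).trans (map_zero _)⟩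

theorem partials_coordT :
    ddx V (coordT V) = 0 ∧ ddy V (coordT V) = 0 ∧
      ddt V (coordT V) = 1 ∧ ddv V (coordT V) = 0 :=
  ⟨(dir_coordT _).trans (map_zero _), (dir_coordT _).trans (map_zero _),
    (dir_coordT _).trans (map_one _), (dir_coordT _).trans (map_zero _)⟩

theorem partials_coordV :
    ddx V (coordV V) = 0 ∧ ddy V (coordV V) = 0 ∧
      ddt V (coordV V) = 0 ∧ ddv V (coordV V) = 1 :=
  ⟨(dir_coordV _).trans (map_zero _), (dir_coordV _).trans (map_zero _),
    (dir_coordV _).trans (map_zero _), (dir_coordV _).trans (map_one _)⟩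

end Coordinates

/-- The components of `X` on `V` are the given smooth functions. -/
def HasComponents (X : Generator) (ξ ζ τ η : smoothAlgebra V) : Prop :=
  ∀ z : V, X z = (ev z ξ, ev z ζ, ev z τ, ev z η)

theorem hasComponents {X : Generator} (hX : ContDiffOn ℝ ∞ X V) :
    HasComponents X (xiX hX) (xiY hX) (tau hX) (eta hX) := fun _ => rfl

theorem HasComponents.isPointSymmetry {X : Generator} {ξ ζ τ η : smoothAlgebra V}
    (h : HasComponents X ξ ζ τ η) {p s : ℝ} (hp : p ≠ 0) (hs : s * s = 1)
    (hd : DeterminingOn V p s ξ ζ τ η) : IsPointSymmetry p s V X := by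
  obtain ⟨a, ha, rfl⟩ := exists_restrict ξ
  obtain ⟨b, hb, rfl⟩ := exists_restrict ζ
  obtain ⟨c, hc, rfl⟩ := exists_restrict τ
  obtain ⟨d, hd', rfl⟩ := exists_restrict η
  have hX : ContDiffOn ℝ ∞ X V :=
    (ha.prodMk (hb.prodMk (hc.prodMk hd'))).congr fun z hz => h ⟨z, hz⟩
  refine DeterminingOn.isPointSymmetry hp hs hX ?_
  have e1 : xiX hX = restrict a ha := ext_ev fun z => congrArg (fun w => w.1) (h z)
  have e2 : xiY hX = restrict b hb := ext_ev fun z => congrArg (fun w => w.2.1) (h z)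
  have e3 : tau hX = restrict c hc := ext_ev fun z => congrArg (fun w => w.2.2.1) (h z)
  have e4 : eta hX = restrict d hd' := ext_ev fun z => congrArg (fun w => w.2.2.2) (h z)
  rwa [e1, e2, e3, e4]

/-- This describes the freedom left in η once ξ, ζ and τ are fixed. -/
theorem exists_shift (hV : Convex ℝ (V : Set Total)) (a : smoothAlgebra V) (hx : ddx V a = 0)
    (hv : ddv V a = 0) (hy : ddy V (ddy V a) = 0) :
    ∃ (f₁ f₂ : ℝ → ℝ) (h₁ : ContDiffOn ℝ ∞ f₁ (timeSet V)) (h₂ : ContDiffOn ℝ ∞ f₂ (timeSet V)),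
      a = timeFun f₁ h₁ + timeFun f₂ h₂ * coordY V := by
  obtain ⟨f₂, h₂, e₂⟩ := exists_timeFun hV (ddy V a) (by rw [ddx_ddy, hx, map_zero]) hy
    (by rw [← ddy_ddv, hv, map_zero])
  obtain ⟨f₁, h₁, e₁⟩ := exists_timeFun hV (a - timeFun f₂ h₂ * coordY V)
    (by simp only [map_sub, Derivation.leibniz, hx, ddx_timeFun, partials_coordY, smul_zero, add_zero,
          sub_zero])
    (by simp only [map_sub, Derivation.leibniz, e₂, ddy_timeFun, partials_coordY, smul_eq_mul,
          mul_one, mul_zero, add_zero, sub_self])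
    (by simp only [map_sub, Derivation.leibniz, hv, ddv_timeFun, partials_coordY, smul_zero, add_zero,
          sub_zero])
  exact ⟨f₁, f₂, h₁, h₂, by rw [← e₁]; ring⟩

end GKP

/-! ### Integration of the determining equations -/

namespace GKP

open TopologicalSpace

variable {V : Opens Total} {p s : ℝ}

/-- The function depends on `t` only, as far as its derivatives tell. -/
structure IsTime (a : smoothAlgebra V) : Prop where
  x : ddx V a = 0
  y : ddy V a = 0
  v : ddv V a = 0

theorem IsTime.ddt {a : smoothAlgebra V} (h : IsTime a) : IsTime (ddt V a) :=
  ⟨by rw [ddx_ddt, h.x, map_zero], by rw [ddy_ddt, h.y, map_zero],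
    by rw [← ddt_ddv, h.v, map_zero]⟩

theorem isTime_timeFun (f : ℝ → ℝ) (hf : ContDiffOn ℝ ∞ f (timeSet V)) : IsTime (timeFun f hf) :=
  ⟨ddx_timeFun f hf, ddy_timeFun f hf, ddv_timeFun f hf⟩

section Families

variable (s : ℝ) (a₃ a₄ a₅ : smoothAlgebra V)

/-- The component along `∂/∂x` of the generator `X7`. -/
noncomputable def xiX7 : smoothAlgebra V :=
  algebraMap ℝ _ (-(1 / 6) * s) * (ddt V (ddt V a₃) * (coordY V * coordY V)) -
    algebraMap ℝ _ (1 / 2 * s) * (ddt V a₄ * coordY V) +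
    algebraMap ℝ _ (1 / 3) * (ddt V a₃ * coordX V) + a₅

/-- The component along `∂/∂y` of the generator `X7`. -/
noncomputable def xiY7 : smoothAlgebra V :=
  algebraMap ℝ _ (2 / 3) * (ddt V a₃ * coordY V) + a₄

/-- The component along `∂/∂v` of the generator `X7`. -/
noncomputable def eta7 : smoothAlgebra V :=
  algebraMap ℝ _ (1 / 72) * (ddt V (ddt V (ddt V (ddt V a₃))) *
      (coordY V * (coordY V * (coordY V * coordY V)))) +
    algebraMap ℝ _ (1 / 12) * (ddt V (ddt V (ddt V a₄)) * (coordY V * (coordY V * coordY V))) -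
    algebraMap ℝ _ (1 / 6 * s) * (ddt V (ddt V (ddt V a₃)) *
      (coordY V * (coordY V * coordX V))) -
    algebraMap ℝ _ (1 / 2 * s) * (ddt V (ddt V a₅) * (coordY V * coordY V)) -
    algebraMap ℝ _ (1 / 2 * s) * (ddt V (ddt V a₄) * (coordY V * coordX V)) +
    algebraMap ℝ _ (1 / 6) * (ddt V (ddt V a₃) * (coordX V * coordX V)) +
    ddt V a₅ * coordX V - algebraMap ℝ _ (1 / 3) * (ddt V a₃ * coordV V)

end Families

theorem ev_ddt_timeFun (f : ℝ → ℝ) (hf : ContDiffOn ℝ ∞ f (timeSet V)) (z : V) :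
    ev z (ddt V (timeFun f hf)) = deriv f z.1.2.2.1 := by
  rw [ddt_timeFun, ev_timeFun]

theorem ev_ddt_ddt_timeFun (f : ℝ → ℝ) (hf : ContDiffOn ℝ ∞ f (timeSet V)) (z : V) :
    ev z (ddt V (ddt V (timeFun f hf))) = iteratedDeriv 2 f z.1.2.2.1 := by
  rw [ddt_timeFun, ev_ddt_timeFun, iteratedDeriv_succ, iteratedDeriv_one]

theorem ev_ddt_ddt_ddt_timeFun (f : ℝ → ℝ) (hf : ContDiffOn ℝ ∞ f (timeSet V)) (z : V) :
    ev z (ddt V (ddt V (ddt V (timeFun f hf)))) = iteratedDeriv 3 f z.1.2.2.1 := by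
  rw [ddt_timeFun, ev_ddt_ddt_timeFun, ← iteratedDeriv_succ']

theorem ev_ddt_ddt_ddt_ddt_timeFun (f : ℝ → ℝ) (hf : ContDiffOn ℝ ∞ f (timeSet V)) (z : V) :
    ev z (ddt V (ddt V (ddt V (ddt V (timeFun f hf))))) = iteratedDeriv 4 f z.1.2.2.1 := by
  rw [ddt_timeFun, ev_ddt_ddt_ddt_timeFun, ← iteratedDeriv_succ']

theorem X7_apply {f₃ f₄ f₅ : ℝ → ℝ} (h₃ : ContDiffOn ℝ ∞ f₃ (timeSet V))
    (h₄ : ContDiffOn ℝ ∞ f₄ (timeSet V)) (h₅ : ContDiffOn ℝ ∞ f₅ (timeSet V)) :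
    HasComponents (X7 s f₃ f₄ f₅)
      (xiX7 s (timeFun f₃ h₃) (timeFun f₄ h₄) (timeFun f₅ h₅))
      (xiY7 (timeFun f₃ h₃) (timeFun f₄ h₄)) (timeFun f₃ h₃)
      (eta7 s (timeFun f₃ h₃) (timeFun f₄ h₄) (timeFun f₅ h₅)) := by
  rintro ⟨⟨x, y, t, v⟩, hz⟩
  simp only [X7, xiX7, xiY7, eta7, map_add, map_sub, map_mul, AlgHom.commutes, Algebra.algebraMap_self,
      RingHom.id_apply, map_one, ev_timeFun,
    ev_coordX, ev_coordY, ev_coordV, ev_ddt_timeFun, ev_ddt_ddt_timeFun, ev_ddt_ddt_ddt_timeFun,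
    ev_ddt_ddt_ddt_ddt_timeFun, Prod.mk.injEq]
  refine ⟨?_, ?_, trivial, ?_⟩ <;> ring

-- The terms of η containing x come from η_x = ξ_t; its y⁴, y³ and y² terms without x then balance
-- η_tx + sη_yy = 0. The relation s² = 1 enters in ζ_t = -2sξ_y and in the last equation.
set_option maxHeartbeats 2000000 in
theorem determiningOn_X7 (hs : s * s = 1) {a₃ a₄ a₅ : smoothAlgebra V} (h₃ : IsTime a₃)
    (h₄ : IsTime a₄) (h₅ : IsTime a₅) :
    DeterminingOn V 1 s (xiX7 s a₃ a₄ a₅) (xiY7 a₃ a₄) a₃ (eta7 s a₃ a₄ a₅) := by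
  have k1 := h₃.ddt
  have k2 := k1.ddt
  have k3 := k2.ddt
  have k4 := k3.ddt
  have l1 := h₄.ddt
  have l2 := l1.ddt
  have l3 := l2.ddt
  have m1 := h₅.ddt
  have m2 := m1.ddt
  refine ⟨h₃.x, h₃.y, h₃.v, ?_, ?_, ?_, ?_, ?_, ?_, ?_, ?_, Or.inl ⟨rfl, ?_⟩⟩ <;>
    refine ext_ev fun z => ?_ <;>
    simp only [xiX7, xiY7, eta7, map_add, map_sub, map_neg, map_zero, map_mul, Derivation.leibniz,
      Derivation.map_algebraMap, smul_eq_mul, partials_coordX, partials_coordY, partials_coordT,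
      partials_coordV, mul_zero, mul_one, zero_mul, add_zero, zero_add, sub_zero, neg_zero,
      Derivation.map_one_eq_zero, AlgHom.commutes, Algebra.algebraMap_self,
      RingHom.id_apply, map_one, h₃.x, h₃.y, h₃.v, h₄.x, h₄.y, h₄.v, h₅.x, h₅.y,
      h₅.v, k1.x, k1.y, k1.v, k2.x, k2.y, k2.v, k3.x, k3.y, k3.v, k4.x, k4.y, k4.v, l1.x, l1.y,
      l1.v, l2.x, l2.y, l2.v, l3.x, l3.y, l3.v, m1.x, m1.y, m1.v, m2.x, m2.y, m2.v]
  all_goals first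
    | ring1
    | linear_combination (2 / 3 * ev z (ddt V (ddt V a₃)) * ev z (coordY V)
        + ev z (ddt V a₄)) * hs * (-1)
    | linear_combination (ev z (ddt V (ddt V (ddt V a₃))) * (1 / 3) * ev z (coordX V)
        + ev z (ddt V (ddt V a₅))) * hs * (-1)

/-- The system is triangular: τ gives f₃; ζ is then known up to a function f₄ of t; its t-derivative
gives ξ_y, so ξ is known up to f₅. -/
theorem exists_eq_X7 (hV : Convex ℝ (V : Set Total)) (hs : s * s = 1) {ξ ζ τ η : smoothAlgebra V}
    (h : DeterminingOn V 1 s ξ ζ τ η) (hη : ddx V η = ddt V ξ) :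
    ∃ (f₁ f₂ f₃ f₄ f₅ : ℝ → ℝ) (h₁ : ContDiffOn ℝ ∞ f₁ (timeSet V))
      (h₂ : ContDiffOn ℝ ∞ f₂ (timeSet V)) (h₃ : ContDiffOn ℝ ∞ f₃ (timeSet V))
      (h₄ : ContDiffOn ℝ ∞ f₄ (timeSet V)) (h₅ : ContDiffOn ℝ ∞ f₅ (timeSet V)),
      ξ = xiX7 s (timeFun f₃ h₃) (timeFun f₄ h₄) (timeFun f₅ h₅) ∧
      ζ = xiY7 (timeFun f₃ h₃) (timeFun f₄ h₄) ∧ τ = timeFun f₃ h₃ ∧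
      η = eta7 s (timeFun f₃ h₃) (timeFun f₄ h₄) (timeFun f₅ h₅) +
        (timeFun f₁ h₁ + timeFun f₂ h₂ * coordY V) := by
  obtain ⟨f₃, h₃, rfl⟩ := exists_timeFun hV τ h.τx h.τy h.τv
  have t3 := isTime_timeFun f₃ h₃
  obtain ⟨a₃, ha₃⟩ : ∃ a₃, a₃ = timeFun f₃ h₃ := ⟨_, rfl⟩
  rw [← ha₃] at h t3 ⊢
  have k1 := t3.ddt
  have k2 := k1.ddt
  obtain ⟨f₄, h₄, e₄⟩ := exists_timeFun hV (ζ - xiY7 a₃ 0)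
    (by simp only [xiY7, map_add, map_sub, map_neg, map_zero, map_mul, Derivation.leibniz,
      Derivation.map_algebraMap, smul_eq_mul, partials_coordX, partials_coordY, partials_coordT,
      partials_coordV, mul_zero, mul_one, zero_mul, add_zero, zero_add, sub_zero, neg_zero,
      Derivation.map_one_eq_zero, h.ζx, k1.x, sub_self])
    (by simp only [xiY7, map_add, map_sub, map_neg, map_zero, map_mul, Derivation.leibniz,
      Derivation.map_algebraMap, smul_eq_mul, partials_coordX, partials_coordY, partials_coordT,
      partials_coordV, mul_zero, mul_one, zero_mul, add_zero, zero_add, sub_zero, neg_zero,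
      Derivation.map_one_eq_zero, h.ζy, k1.y, sub_self])
    (by simp only [xiY7, map_add, map_sub, map_neg, map_zero, map_mul, Derivation.leibniz,
      Derivation.map_algebraMap, smul_eq_mul, partials_coordX, partials_coordY, partials_coordT,
      partials_coordV, mul_zero, mul_one, zero_mul, add_zero, zero_add, sub_zero, neg_zero,
      Derivation.map_one_eq_zero, h.ζv, k1.v, sub_self])
  have t4 := isTime_timeFun f₄ h₄
  obtain ⟨a₄, ha₄⟩ : ∃ a₄, a₄ = timeFun f₄ h₄ := ⟨_, rfl⟩
  rw [← ha₄] at e₄ t4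
  have hζ : ζ = xiY7 a₃ a₄ := by
    rw [← e₄]
    simp only [xiY7]
    ring
  have l1 := t4.ddt
  have ξy : ddy V ξ = algebraMap ℝ _ (-s / 2) *
      (algebraMap ℝ _ (2 / 3) * (ddt V (ddt V a₃) * coordY V) + ddt V a₄) := ext_ev fun z => by
    have h1 := congrArg (ev z) h.ζt
    rw [hζ] at h1
    simp only [xiY7, map_add, map_sub, map_neg, map_zero, map_mul, Derivation.leibniz,
      Derivation.map_algebraMap, smul_eq_mul, partials_coordX, partials_coordY, partials_coordT,
      partials_coordV, mul_zero, mul_one, zero_mul, add_zero, zero_add, sub_zero, neg_zero,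
      Derivation.map_one_eq_zero, AlgHom.commutes, Algebra.algebraMap_self,
      RingHom.id_apply, map_one] at h1 ⊢
    linear_combination (s / 2) * h1 - ev z (ddy V ξ) * hs
  obtain ⟨f₅, h₅, e₅⟩ := exists_timeFun hV (ξ - xiX7 s a₃ a₄ 0)
    (by
      simp only [xiX7, map_add, map_sub, map_neg, map_zero, map_mul, Derivation.leibniz,
      Derivation.map_algebraMap, smul_eq_mul, partials_coordX, partials_coordY, partials_coordT,
      partials_coordV, mul_zero, mul_one, zero_mul, add_zero, zero_add, sub_zero, neg_zero,
      Derivation.map_one_eq_zero, h.ξx, k1.x, k2.x, l1.x, sub_self])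
    (by
      refine ext_ev fun z => ?_
      simp only [xiX7, map_add, map_sub, map_neg, map_zero, map_mul, Derivation.leibniz,
      Derivation.map_algebraMap, smul_eq_mul, partials_coordX, partials_coordY, partials_coordT,
      partials_coordV, mul_zero, mul_one, zero_mul, add_zero, zero_add, sub_zero, neg_zero,
      Derivation.map_one_eq_zero, AlgHom.commutes, Algebra.algebraMap_self,
      RingHom.id_apply, map_one, ξy, k1.y, k2.y, l1.y]
      ring)
    (by
      simp only [xiX7, map_add, map_sub, map_neg, map_zero, map_mul, Derivation.leibniz,
      Derivation.map_algebraMap, smul_eq_mul, partials_coordX, partials_coordY, partials_coordT,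
      partials_coordV, mul_zero, mul_one, zero_mul, add_zero, zero_add, sub_zero, neg_zero,
      Derivation.map_one_eq_zero, h.ξv, k1.v, k2.v, l1.v, sub_self])
  have t5 := isTime_timeFun f₅ h₅
  obtain ⟨a₅, ha₅⟩ : ∃ a₅, a₅ = timeFun f₅ h₅ := ⟨_, rfl⟩
  rw [← ha₅] at e₅ t5
  have hξ : ξ = xiX7 s a₃ a₄ a₅ := by
    rw [← e₅]
    simp only [xiX7]
    ring
  have hd := determiningOn_X7 hs t3 t4 t5
  have hx7 : ddx V (eta7 s a₃ a₄ a₅) = ddt V (xiX7 s a₃ a₄ a₅) := by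
    rcases hd.alt with h | h
    · exact h.2
    · rw [h.1, h.2]
  have hs0 : s ≠ 0 := fun h => by simp [h] at hs
  -- Both functions complete the same ξ, ζ, τ to a solution of the determining equations, so their
  -- difference has zero x- and v-derivatives and zero second y-derivative.
  obtain ⟨f₁, f₂, h₁, h₂, e⟩ := exists_shift hV (η - eta7 s a₃ a₄ a₅)
    (by rw [map_sub, hη, hx7, hξ, sub_self]) (by rw [map_sub, h.ηv, hd.ηv, sub_self])
    (ext_ev fun z => by
      have h1 := congrArg (ev z) h.ηyy
      have h2 := congrArg (ev z) hd.ηyy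
      rw [hη, hξ] at h1
      rw [hx7] at h2
      simp only [map_add, map_mul, map_sub, map_zero, AlgHom.commutes, Algebra.algebraMap_self,
      RingHom.id_apply, map_one] at h1 h2 ⊢
      have : s * (ev z (ddy V (ddy V η)) - ev z (ddy V (ddy V (eta7 s a₃ a₄ a₅)))) = 0 := by
        linear_combination h1 - h2
      simpa [hs0] using this)
  subst ha₃ ha₄ ha₅
  exact ⟨f₁, f₂, f₃, f₄, f₅, h₁, h₂, h₃, h₄, h₅, hξ, hζ, rfl, by rw [← e]; ring⟩

section Basic

variable (p s : ℝ) (c₁ c₂ c₃ c₄ c₅ : ℝ) (b : smoothAlgebra V)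

/-- The components of the basic generators. -/
noncomputable def basicX : smoothAlgebra V :=
  algebraMap ℝ _ c₁ + algebraMap ℝ _ c₄ * coordX V + algebraMap ℝ _ c₅ * coordY V

/-- The component along `∂/∂y` of a basic generator. -/
noncomputable def basicY : smoothAlgebra V :=
  algebraMap ℝ _ c₂ + algebraMap ℝ _ (2 * c₄) * coordY V +
    algebraMap ℝ _ (-2 * s * c₅) * coordT V

/-- The component along `∂/∂t` of a basic generator. -/
noncomputable def basicT : smoothAlgebra V :=
  algebraMap ℝ _ c₃ + algebraMap ℝ _ (3 * c₄) * coordT V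

/-- The component along `∂/∂v` of a basic generator. -/
noncomputable def basicV : smoothAlgebra V :=
  algebraMap ℝ _ ((1 - 2 / p) * c₄) * coordV V + b

end Basic

theorem isBasic_iff {X : Generator} : IsBasic p s V X ↔
    ∃ (c₁ c₂ c₃ c₄ c₅ : ℝ) (f₁ f₂ : ℝ → ℝ) (h₁ : ContDiffOn ℝ ∞ f₁ (timeSet V))
      (h₂ : ContDiffOn ℝ ∞ f₂ (timeSet V)), HasComponents X (basicX c₁ c₄ c₅)
      (basicY s c₂ c₄ c₅) (basicT c₃ c₄)
      (basicV p c₄ (timeFun f₁ h₁ + timeFun f₂ h₂ * coordY V)) := by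
  have key (c₁ c₂ c₃ c₄ c₅ : ℝ) (f₁ f₂ : ℝ → ℝ) (h₁ : ContDiffOn ℝ ∞ f₁ (timeSet V))
      (h₂ : ContDiffOn ℝ ∞ f₂ (timeSet V)) : HasComponents
      (c₁ • X1 + c₂ • X2 + c₃ • X3 + c₄ • X4 p + c₅ • X5 s + X6 f₁ f₂) (basicX c₁ c₄ c₅)
      (basicY s c₂ c₄ c₅) (basicT c₃ c₄)
      (basicV p c₄ (timeFun f₁ h₁ + timeFun f₂ h₂ * coordY V)) := by
    rintro ⟨⟨x, y, t, v⟩, hz⟩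
    simp only [basicX, basicY, basicT, basicV, map_add, map_mul, AlgHom.commutes, Algebra.algebraMap_self,
      RingHom.id_apply, map_one, ev_timeFun, ev_coordX,
      ev_coordY, ev_coordT, ev_coordV, Pi.add_apply, Pi.smul_apply, X1, X2, X3, X4, X5, X6,
      Prod.smul_mk, Prod.mk_add_mk, smul_eq_mul, Prod.mk.injEq]
    refine ⟨?_, ?_, ?_, ?_⟩ <;> ring
  constructor
  · rintro ⟨c₁, c₂, c₃, c₄, c₅, f₁, f₂, h₁, h₂, h⟩
    exact ⟨c₁, c₂, c₃, c₄, c₅, f₁, f₂, h₁, h₂, fun z => (h z.2).trans (key _ _ _ _ _ _ _ h₁ h₂ z)⟩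
  · rintro ⟨c₁, c₂, c₃, c₄, c₅, f₁, f₂, h₁, h₂, h⟩
    exact ⟨c₁, c₂, c₃, c₄, c₅, f₁, f₂, h₁, h₂,
      fun z hz => (h ⟨z, hz⟩).trans (key _ _ _ _ _ _ _ h₁ h₂ ⟨z, hz⟩).symm⟩

theorem determiningOn_basic (c₁ c₂ c₃ c₄ c₅ : ℝ) {b₁ b₂ : smoothAlgebra V} (h₁ : IsTime b₁)
    (h₂ : IsTime b₂) : DeterminingOn V p s (basicX c₁ c₄ c₅) (basicY s c₂ c₄ c₅) (basicT c₃ c₄)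
      (basicV p c₄ (b₁ + b₂ * coordY V)) := by
  refine ⟨?_, ?_, ?_, ?_, ?_, ?_, ?_, ?_, ?_, ?_, ?_, Or.inr ⟨?_, ?_⟩⟩ <;>
    refine ext_ev fun z => ?_ <;>
    simp only [basicX, basicY, basicT, basicV, map_add, map_sub, map_neg, map_zero, map_mul, Derivation.leibniz,
      Derivation.map_algebraMap, smul_eq_mul, partials_coordX, partials_coordY, partials_coordT,
      partials_coordV, mul_zero, mul_one, zero_mul, add_zero, zero_add, sub_zero, neg_zero,
      Derivation.map_one_eq_zero, AlgHom.commutes, Algebra.algebraMap_self,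
      RingHom.id_apply, map_one, h₁.x, h₁.y, h₁.v, h₂.x, h₂.y, h₂.v] <;>
    ring

/-- With ξ_t = 0 the derivative τ_t is a constant d, so c₄ = d/3. Then ζ_y is constant too, whence
ξ_yy = 0 and ξ_y is a constant c₅. Subtracting these contributions leaves constants in ξ, ζ, τ and a
shift in η. -/
theorem exists_eq_basic (hV : Convex ℝ (V : Set Total)) (hn : (V : Set Total).Nonempty)
    (hs : s * s = 1) {ξ ζ τ η : smoothAlgebra V} (h : DeterminingOn V p s ξ ζ τ η)
    (hη : ddx V η = 0) (hξ : ddt V ξ = 0) :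
    ∃ (c₁ c₂ c₃ c₄ c₅ : ℝ) (f₁ f₂ : ℝ → ℝ) (h₁ : ContDiffOn ℝ ∞ f₁ (timeSet V))
      (h₂ : ContDiffOn ℝ ∞ f₂ (timeSet V)), ξ = basicX c₁ c₄ c₅ ∧ ζ = basicY s c₂ c₄ c₅ ∧
      τ = basicT c₃ c₄ ∧ η = basicV p c₄ (timeFun f₁ h₁ + timeFun f₂ h₂ * coordY V) := by
  have hs0 : s ≠ 0 := fun h => by simp [h] at hs
  have Kt : ddt V (ddt V τ) = 0 := ext_ev fun z => by
    have h1 := congrArg (fun a => ev z (ddx V a)) hξ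
    simp only [ddx_ddt, h.ξx, map_add, map_sub, map_neg, map_zero, map_mul, Derivation.leibniz,
      Derivation.map_algebraMap, smul_eq_mul, partials_coordX, partials_coordY, partials_coordT,
      partials_coordV, mul_zero, mul_one, zero_mul, add_zero, zero_add, sub_zero, neg_zero,
      Derivation.map_one_eq_zero, AlgHom.commutes, Algebra.algebraMap_self,
      RingHom.id_apply, map_one] at h1 ⊢
    linear_combination 3 * h1
  have K : IsTime (ddt V τ) := IsTime.ddt ⟨h.τx, h.τy, h.τv⟩
  obtain ⟨d, hd⟩ := exists_eq_algebraMap hV hn _ K.x K.y Kt K.v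
  have ξx := h.ξx
  have ζy := h.ζy
  have ηv := h.ηv
  rw [hd] at ξx ζy ηv
  have ξyy : ddy V (ddy V ξ) = 0 := ext_ev fun z => by
    have h1 := congrArg (fun a => ev z (ddy V a)) h.ζt
    simp only [ddy_ddt, ζy, map_add, map_sub, map_neg, map_zero, map_mul, Derivation.leibniz,
      Derivation.map_algebraMap, smul_eq_mul, partials_coordX, partials_coordY, partials_coordT,
      partials_coordV, mul_zero, mul_one, zero_mul, add_zero, zero_add, sub_zero, neg_zero,
      Derivation.map_one_eq_zero, AlgHom.commutes, Algebra.algebraMap_self,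
      RingHom.id_apply, map_one] at h1 ⊢
    linear_combination (s / 2) * h1 - ev z (ddy V (ddy V ξ)) * hs
  obtain ⟨c₅, h5⟩ := exists_eq_algebraMap hV hn (ddy V ξ)
    (by rw [ddx_ddy, ξx, Derivation.leibniz]; simp only [map_add, map_sub, map_neg, map_zero, map_mul, Derivation.leibniz,
      Derivation.map_algebraMap, smul_eq_mul, partials_coordX, partials_coordY, partials_coordT,
      partials_coordV, mul_zero, mul_one, zero_mul, add_zero, zero_add, sub_zero, neg_zero,
      Derivation.map_one_eq_zero])
    ξyy (by rw [← ddy_ddt, hξ, map_zero]) (by rw [← ddy_ddv, h.ξv, map_zero])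
  have ζt := h.ζt
  rw [h5] at ζt
  obtain ⟨c₁, e₁⟩ := exists_eq_algebraMap hV hn (ξ - basicX 0 (d / 3) c₅)
    (ext_ev fun z => by simp only [basicX, map_add, map_sub, map_neg, map_zero, map_mul, Derivation.leibniz,
      Derivation.map_algebraMap, smul_eq_mul, partials_coordX, partials_coordY, partials_coordT,
      partials_coordV, mul_zero, mul_one, zero_mul, add_zero, zero_add, sub_zero, neg_zero,
      Derivation.map_one_eq_zero, AlgHom.commutes, Algebra.algebraMap_self,
      RingHom.id_apply, map_one, ξx]; ring)
    (ext_ev fun z => by simp only [basicX, map_add, map_sub, map_neg, map_zero, map_mul, Derivation.leibniz,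
      Derivation.map_algebraMap, smul_eq_mul, partials_coordX, partials_coordY, partials_coordT,
      partials_coordV, mul_zero, mul_one, zero_mul, add_zero, zero_add, sub_zero, neg_zero,
      Derivation.map_one_eq_zero, AlgHom.commutes, Algebra.algebraMap_self,
      RingHom.id_apply, map_one, h5]; ring)
    (ext_ev fun z => by simp only [basicX, map_add, map_sub, map_neg, map_zero, map_mul, Derivation.leibniz,
      Derivation.map_algebraMap, smul_eq_mul, partials_coordX, partials_coordY, partials_coordT,
      partials_coordV, mul_zero, mul_one, zero_mul, add_zero, zero_add, sub_zero, neg_zero,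
      Derivation.map_one_eq_zero, AlgHom.commutes, Algebra.algebraMap_self,
      RingHom.id_apply, map_one, hξ])
    (ext_ev fun z => by simp only [basicX, map_add, map_sub, map_neg, map_zero, map_mul, Derivation.leibniz,
      Derivation.map_algebraMap, smul_eq_mul, partials_coordX, partials_coordY, partials_coordT,
      partials_coordV, mul_zero, mul_one, zero_mul, add_zero, zero_add, sub_zero, neg_zero,
      Derivation.map_one_eq_zero, AlgHom.commutes, Algebra.algebraMap_self,
      RingHom.id_apply, map_one, h.ξv])
  obtain ⟨c₂, e₂⟩ := exists_eq_algebraMap hV hn (ζ - basicY s 0 (d / 3) c₅)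
    (ext_ev fun z => by simp only [basicY, map_add, map_sub, map_neg, map_zero, map_mul, Derivation.leibniz,
      Derivation.map_algebraMap, smul_eq_mul, partials_coordX, partials_coordY, partials_coordT,
      partials_coordV, mul_zero, mul_one, zero_mul, add_zero, zero_add, sub_zero, neg_zero,
      Derivation.map_one_eq_zero, AlgHom.commutes, Algebra.algebraMap_self,
      RingHom.id_apply, map_one, h.ζx])
    (ext_ev fun z => by simp only [basicY, map_add, map_sub, map_neg, map_zero, map_mul, Derivation.leibniz,
      Derivation.map_algebraMap, smul_eq_mul, partials_coordX, partials_coordY, partials_coordT,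
      partials_coordV, mul_zero, mul_one, zero_mul, add_zero, zero_add, sub_zero, neg_zero,
      Derivation.map_one_eq_zero, AlgHom.commutes, Algebra.algebraMap_self,
      RingHom.id_apply, map_one, ζy]; ring)
    (ext_ev fun z => by simp only [basicY, map_add, map_sub, map_neg, map_zero, map_mul, Derivation.leibniz,
      Derivation.map_algebraMap, smul_eq_mul, partials_coordX, partials_coordY, partials_coordT,
      partials_coordV, mul_zero, mul_one, zero_mul, add_zero, zero_add, sub_zero, neg_zero,
      Derivation.map_one_eq_zero, AlgHom.commutes, Algebra.algebraMap_self,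
      RingHom.id_apply, map_one, ζt]; ring)
    (ext_ev fun z => by simp only [basicY, map_add, map_sub, map_neg, map_zero, map_mul, Derivation.leibniz,
      Derivation.map_algebraMap, smul_eq_mul, partials_coordX, partials_coordY, partials_coordT,
      partials_coordV, mul_zero, mul_one, zero_mul, add_zero, zero_add, sub_zero, neg_zero,
      Derivation.map_one_eq_zero, AlgHom.commutes, Algebra.algebraMap_self,
      RingHom.id_apply, map_one, h.ζv])
  obtain ⟨c₃, e₃⟩ := exists_eq_algebraMap hV hn (τ - basicT 0 (d / 3))
    (ext_ev fun z => by simp only [basicT, map_add, map_sub, map_neg, map_zero, map_mul, Derivation.leibniz,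
      Derivation.map_algebraMap, smul_eq_mul, partials_coordX, partials_coordY, partials_coordT,
      partials_coordV, mul_zero, mul_one, zero_mul, add_zero, zero_add, sub_zero, neg_zero,
      Derivation.map_one_eq_zero, AlgHom.commutes, Algebra.algebraMap_self,
      RingHom.id_apply, map_one, h.τx])
    (ext_ev fun z => by simp only [basicT, map_add, map_sub, map_neg, map_zero, map_mul, Derivation.leibniz,
      Derivation.map_algebraMap, smul_eq_mul, partials_coordX, partials_coordY, partials_coordT,
      partials_coordV, mul_zero, mul_one, zero_mul, add_zero, zero_add, sub_zero, neg_zero,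
      Derivation.map_one_eq_zero, AlgHom.commutes, Algebra.algebraMap_self,
      RingHom.id_apply, map_one, h.τy])
    (ext_ev fun z => by simp only [basicT, map_add, map_sub, map_neg, map_zero, map_mul, Derivation.leibniz,
      Derivation.map_algebraMap, smul_eq_mul, partials_coordX, partials_coordY, partials_coordT,
      partials_coordV, mul_zero, mul_one, zero_mul, add_zero, zero_add, sub_zero, neg_zero,
      Derivation.map_one_eq_zero, AlgHom.commutes, Algebra.algebraMap_self,
      RingHom.id_apply, map_one, hd]; ring)
    (ext_ev fun z => by simp only [basicT, map_add, map_sub, map_neg, map_zero, map_mul, Derivation.leibniz,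
      Derivation.map_algebraMap, smul_eq_mul, partials_coordX, partials_coordY, partials_coordT,
      partials_coordV, mul_zero, mul_one, zero_mul, add_zero, zero_add, sub_zero, neg_zero,
      Derivation.map_one_eq_zero, AlgHom.commutes, Algebra.algebraMap_self,
      RingHom.id_apply, map_one, h.τv])
  obtain ⟨f₁, f₂, h₁, h₂, e⟩ := exists_shift hV (η - basicV p (d / 3) 0)
    (ext_ev fun z => by simp only [basicV, map_add, map_sub, map_neg, map_zero, map_mul, Derivation.leibniz,
      Derivation.map_algebraMap, smul_eq_mul, partials_coordX, partials_coordY, partials_coordT,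
      partials_coordV, mul_zero, mul_one, zero_mul, add_zero, zero_add, sub_zero, neg_zero,
      Derivation.map_one_eq_zero, AlgHom.commutes, Algebra.algebraMap_self,
      RingHom.id_apply, map_one, hη])
    (ext_ev fun z => by simp only [basicV, map_add, map_sub, map_neg, map_zero, map_mul, Derivation.leibniz,
      Derivation.map_algebraMap, smul_eq_mul, partials_coordX, partials_coordY, partials_coordT,
      partials_coordV, mul_zero, mul_one, zero_mul, add_zero, zero_add, sub_zero, neg_zero,
      Derivation.map_one_eq_zero, AlgHom.commutes, Algebra.algebraMap_self,
      RingHom.id_apply, map_one, ηv]; ring)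
    (ext_ev fun z => by
      have h1 := congrArg (ev z) h.ηyy
      rw [hη] at h1
      simp only [basicV, map_add, map_sub, map_neg, map_zero, map_mul, Derivation.leibniz,
      Derivation.map_algebraMap, smul_eq_mul, partials_coordX, partials_coordY, partials_coordT,
      partials_coordV, mul_zero, mul_one, zero_mul, add_zero, zero_add, sub_zero, neg_zero,
      Derivation.map_one_eq_zero, AlgHom.commutes, Algebra.algebraMap_self,
      RingHom.id_apply, map_one] at h1 ⊢
      simpa [hs0] using h1)
  refine ⟨c₁, c₂, c₃, d / 3, c₅, f₁, f₂, h₁, h₂, ?_, ?_, ?_, ?_⟩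
  · rw [sub_eq_iff_eq_add.1 e₁]
    simp only [basicX, map_zero]
    ring
  · rw [sub_eq_iff_eq_add.1 e₂]
    simp only [basicY, map_zero]
    ring
  · rw [sub_eq_iff_eq_add.1 e₃]
    simp only [basicT, map_zero]
    ring
  · rw [sub_eq_iff_eq_add.1 e]
    simp only [basicV]
    ring

theorem HasComponents.isBasic {X : Generator} (hV : Convex ℝ (V : Set Total))
    (hn : (V : Set Total).Nonempty) (hs : s * s = 1) {ξ ζ τ η : smoothAlgebra V}
    (hX : HasComponents X ξ ζ τ η) (h : DeterminingOn V p s ξ ζ τ η)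
    (hη : ddx V η = 0) (hξ : ddt V ξ = 0) : IsBasic p s V X := by
  obtain ⟨c₁, c₂, c₃, c₄, c₅, f₁, f₂, h₁, h₂, rfl, rfl, rfl, rfl⟩ :=
    exists_eq_basic hV hn hs h hη hξ
  exact isBasic_iff.2 ⟨c₁, c₂, c₃, c₄, c₅, f₁, f₂, h₁, h₂, hX⟩

theorem HasComponents.unique {X Y : Generator} {ξ ζ τ η ξ' ζ' τ' η' : smoothAlgebra V}
    (hX : HasComponents X ξ ζ τ η) (hY : HasComponents Y ξ' ζ' τ' η') (h : Set.EqOn X Y V) :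
    ξ = ξ' ∧ ζ = ζ' ∧ τ = τ' ∧ η = η' := by
  have key (z : V) : (ev z ξ, ev z ζ, ev z τ, ev z η) = (ev z ξ', ev z ζ', ev z τ', ev z η') :=
    (hX z).symm.trans ((h z.2).trans (hY z))
  simp only [Prod.mk.injEq] at key
  exact ⟨ext_ev fun z => (key z).1, ext_ev fun z => (key z).2.1, ext_ev fun z => (key z).2.2.1,
    ext_ev fun z => (key z).2.2.2⟩

/-- The three functions are read off in turn from τ, ζ and ξ, where f₄ and f₅ are the last summands.
-/
theorem X7_injective {f₃ f₄ f₅ g₃ g₄ g₅ : ℝ → ℝ} (hf₃ : ContDiffOn ℝ ∞ f₃ (timeSet V))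
    (hf₄ : ContDiffOn ℝ ∞ f₄ (timeSet V)) (hf₅ : ContDiffOn ℝ ∞ f₅ (timeSet V))
    (hg₃ : ContDiffOn ℝ ∞ g₃ (timeSet V)) (hg₄ : ContDiffOn ℝ ∞ g₄ (timeSet V))
    (hg₅ : ContDiffOn ℝ ∞ g₅ (timeSet V)) (h : Set.EqOn (X7 s f₃ f₄ f₅) (X7 s g₃ g₄ g₅) V) :
    Set.EqOn f₃ g₃ (timeSet V) ∧ Set.EqOn f₄ g₄ (timeSet V) ∧ Set.EqOn f₅ g₅ (timeSet V) := by
  obtain ⟨hξ, hζ, hτ, -⟩ := (X7_apply hf₃ hf₄ hf₅).unique (X7_apply hg₃ hg₄ hg₅) h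
  rw [hτ] at hξ hζ
  have h4 := add_left_cancel hζ
  rw [h4] at hξ
  exact ⟨timeFun_eq_iff.1 hτ, timeFun_eq_iff.1 h4, timeFun_eq_iff.1 (add_left_cancel hξ)⟩

/-- A basic generator has affine τ and ζ and a ξ independent of t, which forces the three
conditions. Conversely they give ξ_t = 0, hence η_x = 0, and `exists_eq_basic` applies. -/
theorem isBasic_X7_iff (hV : Convex ℝ (V : Set Total)) (hn : (V : Set Total).Nonempty)
    (hs : s * s = 1) {f₃ f₄ f₅ : ℝ → ℝ} (h₃ : ContDiffOn ℝ ∞ f₃ (timeSet V))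
    (h₄ : ContDiffOn ℝ ∞ f₄ (timeSet V)) (h₅ : ContDiffOn ℝ ∞ f₅ (timeSet V)) :
    IsBasic 1 s V (X7 s f₃ f₄ f₅) ↔ ∀ t ∈ timeSet V, iteratedDeriv 2 f₃ t = 0 ∧
      iteratedDeriv 2 f₄ t = 0 ∧ deriv f₅ t = 0 := by
  have hX := X7_apply (s := s) h₃ h₄ h₅
  obtain ⟨a₃, ha₃⟩ : ∃ a₃, a₃ = timeFun f₃ h₃ := ⟨_, rfl⟩
  obtain ⟨a₄, ha₄⟩ : ∃ a₄, a₄ = timeFun f₄ h₄ := ⟨_, rfl⟩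
  obtain ⟨a₅, ha₅⟩ : ∃ a₅, a₅ = timeFun f₅ h₅ := ⟨_, rfl⟩
  have t3 : IsTime a₃ := ha₃ ▸ isTime_timeFun f₃ h₃
  have t4 : IsTime a₄ := ha₄ ▸ isTime_timeFun f₄ h₄
  have t5 : IsTime a₅ := ha₅ ▸ isTime_timeFun f₅ h₅
  rw [← ha₃, ← ha₄, ← ha₅] at hX
  have hiff : (∀ t ∈ timeSet V, iteratedDeriv 2 f₃ t = 0 ∧ iteratedDeriv 2 f₄ t = 0 ∧
      deriv f₅ t = 0) ↔ ddt V (ddt V a₃) = 0 ∧ ddt V (ddt V a₄) = 0 ∧ ddt V a₅ = 0 := by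
    subst ha₃ ha₄ ha₅
    constructor
    · intro h
      refine ⟨ext_ev fun z => ?_, ext_ev fun z => ?_, ext_ev fun z => ?_⟩
      · rw [ev_ddt_ddt_timeFun, (h _ (mem_timeSet z)).1, map_zero]
      · rw [ev_ddt_ddt_timeFun, (h _ (mem_timeSet z)).2.1, map_zero]
      · rw [ev_ddt_timeFun, (h _ (mem_timeSet z)).2.2, map_zero]
    · rintro ⟨e3, e4, e5⟩ _ ⟨z, hz, rfl⟩
      have i3 := congrArg (ev ⟨z, hz⟩) e3
      have i4 := congrArg (ev ⟨z, hz⟩) e4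
      have i5 := congrArg (ev ⟨z, hz⟩) e5
      rw [ev_ddt_ddt_timeFun, map_zero] at i3 i4
      rw [ev_ddt_timeFun, map_zero] at i5
      exact ⟨i3, i4, i5⟩
  rw [hiff]
  constructor
  · intro h
    obtain ⟨c₁, c₂, c₃, c₄, c₅, f₁, f₂, h₁, h₂, hB⟩ := isBasic_iff.1 h
    obtain ⟨hξ, hζ, hτ, -⟩ := hX.unique hB fun _ _ => rfl
    have e3 : ddt V a₃ = algebraMap ℝ _ (3 * c₄) := by
      rw [hτ]
      simp only [basicT, map_add, map_sub, map_neg, map_zero, map_mul, Derivation.leibniz,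
      Derivation.map_algebraMap, smul_eq_mul, partials_coordX, partials_coordY, partials_coordT,
      partials_coordV, mul_zero, mul_one, zero_mul, add_zero, zero_add, sub_zero, neg_zero,
      Derivation.map_one_eq_zero]
    have e33 : ddt V (ddt V a₃) = 0 := by rw [e3, Derivation.map_algebraMap]
    have e4 := congrArg (ddt V) hζ
    simp only [xiY7, basicY, map_add, map_sub, map_neg, map_zero, map_mul, Derivation.leibniz,
      Derivation.map_algebraMap, smul_eq_mul, partials_coordX, partials_coordY, partials_coordT,
      partials_coordV, mul_zero, mul_one, zero_mul, add_zero, zero_add, sub_zero, neg_zero,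
      Derivation.map_one_eq_zero, e33] at e4
    have e44 : ddt V (ddt V a₄) = 0 := by
      rw [e4]
      simp only [map_add, map_sub, map_neg, map_zero, map_mul, Derivation.leibniz,
      Derivation.map_algebraMap, smul_eq_mul, partials_coordX, partials_coordY, partials_coordT,
      partials_coordV, mul_zero, mul_one, zero_mul, add_zero, zero_add, sub_zero, neg_zero,
      Derivation.map_one_eq_zero]
    have e5 := congrArg (ddt V) hξ
    simp only [xiX7, basicX, map_add, map_sub, map_neg, map_zero, map_mul, Derivation.leibniz,
      Derivation.map_algebraMap, smul_eq_mul, partials_coordX, partials_coordY, partials_coordT,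
      partials_coordV, mul_zero, mul_one, zero_mul, add_zero, zero_add, sub_zero, neg_zero,
      Derivation.map_one_eq_zero, e33, e44] at e5
    exact ⟨e33, e44, by simpa only [sub_self, zero_add] using e5⟩
  · rintro ⟨e3, e4, e5⟩
    have hd := determiningOn_X7 hs t3 t4 t5
    have hξ : ddt V (xiX7 s a₃ a₄ a₅) = 0 := by
      simp only [xiX7, map_add, map_sub, map_neg, map_zero, map_mul, Derivation.leibniz,
      Derivation.map_algebraMap, smul_eq_mul, partials_coordX, partials_coordY, partials_coordT,
      partials_coordV, mul_zero, mul_one, zero_mul, add_zero, zero_add, sub_zero, neg_zero,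
      Derivation.map_one_eq_zero, e3, e4, e5, sub_self]
    refine hX.isBasic hV hn hs hd ?_ hξ
    rcases hd.alt with h | h
    · rw [h.2, hξ]
    · exact h.1

theorem X7_scaling (s : ℝ) : X7 s (fun t => 3 * t) 0 0 = X4 1 := by
  have d0 : deriv (0 : ℝ → ℝ) = 0 := by
    funext t
    simp
  have d1 : deriv (fun t : ℝ => 3 * t) = fun _ => 3 := by
    funext t
    simp
  have d2 : deriv (fun _ : ℝ => (3 : ℝ)) = 0 := by
    funext t
    simp
  funext ⟨x, y, t, v⟩
  simp only [X7, X4, iteratedDeriv_succ', iteratedDeriv_zero, d1, d2, d0, Pi.zero_apply,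
    Prod.mk.injEq]
  refine ⟨?_, ?_, trivial, ?_⟩ <;> ring

end GKP

/-! ### The classification of point symmetries -/

theorem theorem3p1 (p : ℝ) (hp : p ≠ 0) (s : ℝ) (hs : s = 1 ∨ s = -1)
    (W : Set GKP.Total) (hWo : IsOpen W) (hWc : Convex ℝ W) (hWn : W.Nonempty) :
    -- the basic generators are point symmetries for every nonzero `p`
    (∀ X : GKP.Generator, GKP.IsBasic p s W X → GKP.IsPointSymmetry p s W X) ∧
    -- there are no others unless `p = 1`
    (p ≠ 1 → ∀ X : GKP.Generator, GKP.IsPointSymmetry p s W X → GKP.IsBasic p s W X) ∧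
    (p = 1 →
      -- the additional families consist of point symmetries
      (∀ f₃ f₄ f₅ : ℝ → ℝ, ContDiffOn ℝ ∞ f₃ (GKP.timeSet W) →
        ContDiffOn ℝ ∞ f₄ (GKP.timeSet W) → ContDiffOn ℝ ∞ f₅ (GKP.timeSet W) →
        GKP.IsPointSymmetry p s W (GKP.X7 s f₃ f₄ f₅)) ∧
      -- together with the shifts they exhaust the point symmetries
      (∀ X : GKP.Generator, GKP.IsPointSymmetry p s W X →
        ∃ f₁ f₂ f₃ f₄ f₅ : ℝ → ℝ, ContDiffOn ℝ ∞ f₁ (GKP.timeSet W) ∧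
          ContDiffOn ℝ ∞ f₂ (GKP.timeSet W) ∧ ContDiffOn ℝ ∞ f₃ (GKP.timeSet W) ∧
          ContDiffOn ℝ ∞ f₄ (GKP.timeSet W) ∧ ContDiffOn ℝ ∞ f₅ (GKP.timeSet W) ∧
          Set.EqOn X (GKP.X6 f₁ f₂ + GKP.X7 s f₃ f₄ f₅) W) ∧
      -- different functions give different generators: the families are infinite-dimensional
      (∀ f₃ f₄ f₅ g₃ g₄ g₅ : ℝ → ℝ, ContDiffOn ℝ ∞ f₃ (GKP.timeSet W) →
        ContDiffOn ℝ ∞ f₄ (GKP.timeSet W) → ContDiffOn ℝ ∞ f₅ (GKP.timeSet W) →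
        ContDiffOn ℝ ∞ g₃ (GKP.timeSet W) → ContDiffOn ℝ ∞ g₄ (GKP.timeSet W) →
        ContDiffOn ℝ ∞ g₅ (GKP.timeSet W) →
        Set.EqOn (GKP.X7 s f₃ f₄ f₅) (GKP.X7 s g₃ g₄ g₅) W →
        Set.EqOn f₃ g₃ (GKP.timeSet W) ∧ Set.EqOn f₄ g₄ (GKP.timeSet W) ∧
          Set.EqOn f₅ g₅ (GKP.timeSet W)) ∧
      -- exactly which of their members are not additional
      (∀ f₃ f₄ f₅ : ℝ → ℝ, ContDiffOn ℝ ∞ f₃ (GKP.timeSet W) →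
        ContDiffOn ℝ ∞ f₄ (GKP.timeSet W) → ContDiffOn ℝ ∞ f₅ (GKP.timeSet W) →
        (GKP.IsBasic p s W (GKP.X7 s f₃ f₄ f₅) ↔
          ∀ t ∈ GKP.timeSet W, iteratedDeriv 2 f₃ t = 0 ∧ iteratedDeriv 2 f₄ t = 0 ∧
            deriv f₅ t = 0)) ∧
      -- the scaling is a member
      GKP.X7 s (fun t => 3 * t) 0 0 = GKP.X4 p) := by
  have hss : s * s = 1 := by rcases hs with rfl | rfl <;> norm_num
  obtain ⟨V, rfl⟩ : ∃ V : TopologicalSpace.Opens GKP.Total, W = (V : Set GKP.Total) := ⟨⟨W, hWo⟩, rfl⟩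
  refine ⟨fun X hX => ?_, fun hp1 X hX => ?_, ?_⟩
  · obtain ⟨c₁, c₂, c₃, c₄, c₅, f₁, f₂, h₁, h₂, h⟩ := GKP.isBasic_iff.1 hX
    exact h.isPointSymmetry hp hss (GKP.determiningOn_basic _ _ _ _ _
      (GKP.isTime_timeFun f₁ h₁) (GKP.isTime_timeFun f₂ h₂))
  · have hd := hX.determiningOn hp hss
    rcases hd.alt with h | h
    · exact absurd h.1 hp1
    · exact (GKP.hasComponents hX.contDiffOn).isBasic hWc hWn hss hd h.1 h.2
  · rintro rfl
    refine ⟨fun f₃ f₄ f₅ h₃ h₄ h₅ => ?_, fun X hX => ?_,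
      fun f₃ f₄ f₅ g₃ g₄ g₅ h₃ h₄ h₅ k₃ k₄ k₅ h => GKP.X7_injective h₃ h₄ h₅ k₃ k₄ k₅ h,
      fun f₃ f₄ f₅ h₃ h₄ h₅ => GKP.isBasic_X7_iff hWc hWn hss h₃ h₄ h₅, GKP.X7_scaling s⟩
    · exact (GKP.X7_apply h₃ h₄ h₅).isPointSymmetry hp hss (GKP.determiningOn_X7 hss
        (GKP.isTime_timeFun f₃ h₃) (GKP.isTime_timeFun f₄ h₄) (GKP.isTime_timeFun f₅ h₅))
    · have hd := hX.determiningOn hp hss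
      have hη : GKP.ddx V (GKP.eta hX.contDiffOn) = GKP.ddt V (GKP.xiX hX.contDiffOn) := by
        -- For p = 1 both alternatives give η_x = ξ_t; in the second one both sides are zero.
        rcases hd.alt with h | h
        · exact h.2
        · rw [h.1, h.2]
      obtain ⟨f₁, f₂, f₃, f₄, f₅, h₁, h₂, h₃, h₄, h₅, e₁, e₂, e₃, e₄⟩ :=
        GKP.exists_eq_X7 hWc hss hd hη
      refine ⟨f₁, f₂, f₃, f₄, f₅, h₁, h₂, h₃, h₄, h₅, fun z hz => ?_⟩
      have h1 := GKP.hasComponents hX.contDiffOn ⟨z, hz⟩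
      have h2 := GKP.X7_apply (s := s) h₃ h₄ h₅ ⟨z, hz⟩
      rw [e₁, e₂, e₃, e₄] at h1
      rw [h1, Pi.add_apply, h2]
      simp [GKP.X6, add_comm]
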